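/- Let $n\ge 1$ and let $\mathcal D=\bigcup_{k\in\mathbb Z}\mathcal D_k$ be a dyadic system on $\mathbb R^n$: each $\mathcal D_k$ is a partition of $\mathbb R^n$ into half-open cubes $\prod_i[c_i,c_i+2^{-k})$, and any two cubes of $\mathcal D$ are disjoint or nested. For $Q\in\mathcal D_k$ let $\widehat Q\in\mathcal D_{k-1}$ be the cube containing $Q$ and $\mathcal D_r(Q)=\{R\in\mathcal D_{k+r}:R\subseteq Q\}$. Let $\mu$ be a Borel measure on $\mathbb R^n$ with $0<\mu(Q)<\infty$ for all $Q\in\mathcal D$, and write $\langle f\rangle_Q=\mu(Q)^{-1}\int_Q f\,d\mu$, $\langle f,g\rangle=\int fg\,d\mu$. Let $\{h_Q^j\}_{Q\in\mathcal D,\,1\le j\le 2^n-1}$ be a Haar system for $\mu$: an orthonormal family in $L^2(\mu)$ of real functions such that $h_Q^j$ is supported on $Q$, is constant on each cube of $\mathcal D_1(Q)$, and has integral $0$. Assume that $\mu$ is balanced: $$\sup_{Q\in\mathcal D}\ \sup_{R\in\mathcal D_1(Q)}\ \sup_{i,j}\Big[\|h_Q^i\|_{L^1(\mu)}\|h_R^j\|_{L^\infty(\mu)}+\|h_Q^i\|_{L^\infty(\mu)}\|h_R^j\|_{L^1(\mu)}\Big]<\infty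 .$$ For $1<q<\infty$ and $\alpha>0$ let $\Lambda_q(\alpha)$ be the set of real $f\in L^q_{\mathrm{loc}}(\mu)$ with $$\|f\|_{\Lambda_q(\alpha)}:=\sup_{Q\in\mathcal D}\frac1{\mu(Q)^{1/q+\alpha}}\Big(\int_Q|f-\langle f\rangle_{\widehat Q}|^q\,d\mu\Big)^{1/q}<\infty .$$ A Haar shift of complexity $(r,s)\in\mathbb N\times\mathbb N$ is an operator of the form $$Tf=\sum_{Q\in\mathcal D}t_Q(f),\qquad t_Q(f)=\sum_{R\in\mathcal D_r(Q)}\ \sum_{S\in\mathcal D_s(Q)}\ \sum_{i,j}\alpha^{Q,i,j}_{R,S}\,\langle f,h_R^i\rangle\,h_S^j ,$$ with real coefficients $\alpha^{Q,i,j}_{R,S}$; it is bounded on $L^2(\mu)$ if for every $f\in L^2(\mu)$ the series converges unconditionally in $L^2(\mu)$ and this defines a bounded operator $T$ on $L^2(\mu)$. For $f\in L^q_{\mathrm{loc}}(\mu)$, we say that $g\in L^q_{\mathrm{loc}}(\mu)$ represents $Tf$ if for every $P\in\mathcal D$ the series $\sum_{Q}\big(t_Q(f)-\langle t_Q(f)\rangle_P\big)$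 converges unconditionally in $L^q(P,\mu)$ to $g-\langle g\rangle_P$; up to $\mu$-null sets, this determines $g$ up to functions that are constant on each cube of $\mathcal D$, and such functions have zero $\Lambda_q(\alpha)$-seminorm. **Theorem.** Let $r,s\in\mathbb N$, $1<q<\infty$ and $\alpha>0$. There is a constant $C<\infty$, depending only on $\mathcal D$, $\mu$, $\{h_Q^j\}$, $r$, $s$, $q$, $\alpha$, such that for every Haar shift $T$ of complexity $(r,s)$ that is bounded on $L^2(\mu)$ and every $f\in\Lambda_q(\alpha)$: there is a $g\in L^q_{\mathrm{loc}}(\mu)$ that represents $Tf$; if moreover $f\in L^2(\mu)$, then the $L^2(\mu)$-function $Tf$ represents $Tf$; and every $g$ that represents $Tf$ belongs to $\Lambda_q(\alpha)$ and satisfies $$\|g\|_{\Lambda_q(\alpha)}\le C\,\|T\|_{L^2(\mu)\to L^2(\mu)}\,\|f\|_{\Lambda_q(\alpha)},$$ that is, $\|Tf\|_{\Lambda_q(\alpha)}\lesssim\|f\|_{\Lambda_q(\alpha)}$. -/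

import Mathlib

open MeasureTheory Filter Topology
open scoped ENNReal NNReal

noncomputable section

/-- Labels `(k, j) ∈ ℤ × ℤⁿ` of dyadic cubes: `k` is the generation, `j` the position. -/
abbrev CubeIndex (n : ℕ) : Type := ℤ × (Fin n → ℤ)

/-- The half-open cube with lower corner `c` and side length `2⁻ᵏ`. -/
def halfOpenCube {n : ℕ} (k : ℤ) (c : Fin n → ℝ) : Set (Fin n → ℝ) :=
  Set.pi Set.univ fun i => Set.Ico (c i) (c i + (2 : ℝ) ^ (-k))

/-- A dyadic system on `ℝⁿ`: for each `k ∈ ℤ` a family, labelled by `ℤⁿ`, of half-open cubes of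
side length `2⁻ᵏ` partitioning `ℝⁿ`, such that any two cubes of the system are disjoint or
nested. -/
structure DyadicSystem (n : ℕ) where
  /-- the lower corner of the cube labelled `(k, j)` -/
  corner : CubeIndex n → (Fin n → ℝ)
  partition : ∀ (k : ℤ) (x : Fin n → ℝ), ∃! j : Fin n → ℤ, x ∈ halfOpenCube k (corner (k, j))
  nested : ∀ Q R : CubeIndex n,
    Disjoint (halfOpenCube Q.1 (corner Q)) (halfOpenCube R.1 (corner R)) ∨
      halfOpenCube Q.1 (corner Q) ⊆ halfOpenCube R.1 (corner R) ∨
      halfOpenCube R.1 (corner R) ⊆ halfOpenCube Q.1 (corner Q)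

namespace DyadicSystem

variable {n : ℕ} (D : DyadicSystem n)

/-- The cube labelled `Q`, as a subset of `ℝⁿ`. -/
def cube (Q : CubeIndex n) : Set (Fin n → ℝ) := halfOpenCube Q.1 (D.corner Q)

/-- The (label of the) cube of generation `k` that contains the point `x`. -/
def cubeAt (k : ℤ) (x : Fin n → ℝ) : CubeIndex n := (k, (D.partition k x).choose)

/-- The dyadic parent `Q̂`: the cube of the previous generation that contains `Q`
(see `cube_subset_cube_parent`). -/
def parent (Q : CubeIndex n) : CubeIndex n := D.cubeAt (Q.1 - 1) (D.corner Q)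

theorem mem_cube_cubeAt (k : ℤ) (x : Fin n → ℝ) : x ∈ D.cube (D.cubeAt k x) :=
  (D.partition k x).choose_spec.1

theorem corner_mem_cube (Q : CubeIndex n) : D.corner Q ∈ D.cube Q := by
  intro i _
  exact ⟨le_refl _, by linarith [zpow_pos (two_pos : (0 : ℝ) < 2) (-Q.1)]⟩

theorem cube_subset_cube_parent (Q : CubeIndex n) : D.cube Q ⊆ D.cube (D.parent Q) := by
  have h1 : D.corner Q ∈ D.cube (D.parent Q) := D.mem_cube_cubeAt _ _
  have h2 := D.corner_mem_cube Q
  rcases D.nested Q (D.parent Q) with h | h | h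
  · exact absurd h1 (Set.disjoint_left.1 h h2)
  · exact h
  · intro y _ i hi
    exfalso
    have hp := zpow_pos (two_pos : (0 : ℝ) < 2) (-Q.1)
    have hk : (2 : ℝ) ^ (-(D.parent Q).1) = 2 * 2 ^ (-Q.1) := by
      have : -(D.parent Q).1 = 1 + -Q.1 := by
        change -(Q.1 - 1) = _
        ring
      rw [this, zpow_add₀ two_ne_zero, zpow_one]
    have hc : D.corner (D.parent Q) ∈ D.cube Q := h (D.corner_mem_cube _)
    have hz : (fun m => D.corner (D.parent Q) m + (2 : ℝ) ^ (-Q.1)) ∈ D.cube Q := by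
      apply h
      intro m _
      simp only [Set.mem_Ico, hk]
      constructor <;> linarith
    have e1 := (hc i hi).1
    have e2 := (hz i hi).2
    simp only at e2
    linarith

theorem measurableSet_cube (Q : CubeIndex n) : MeasurableSet (D.cube Q) :=
  MeasurableSet.univ_pi fun _ => measurableSet_Ico

theorem finite_descendants (r : ℕ) (Q : CubeIndex n) :
    {R : CubeIndex n | R.1 = Q.1 + r ∧ D.cube R ⊆ D.cube Q}.Finite := by
  set A := {R : CubeIndex n | R.1 = Q.1 + r ∧ D.cube R ⊆ D.cube Q}
  have hvol : ∀ R : CubeIndex n,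
      volume (D.cube R) = ENNReal.ofReal ((2 : ℝ) ^ (-R.1)) ^ n := by
    intro R
    simp [cube, halfOpenCube, volume_pi_pi, Real.volume_Ico]
  have hpos : 0 < ENNReal.ofReal ((2 : ℝ) ^ (-(Q.1 + r))) ^ n :=
    ENNReal.pow_pos (ENNReal.ofReal_pos.2 (zpow_pos two_pos _)) n
  have hfin := Measure.finite_const_le_meas_of_disjoint_iUnion (volume : Measure (Fin n → ℝ))
    (ι := A) (As := fun R => D.cube R.1) hpos
    (fun R => D.measurableSet_cube R.1)
    (by
      intro R S hRS
      refine Set.disjoint_left.2 fun x hxR hxS => hRS ?_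
      obtain ⟨⟨k, j⟩, hR⟩ := R
      obtain ⟨⟨k', j'⟩, hS⟩ := S
      have hkk : k = k' := hR.1.trans hS.1.symm
      subst hkk
      have := (D.partition k x).unique hxR hxS
      subst this
      rfl)
    (by
      refine ne_top_of_le_ne_top ?_ (measure_mono (t := D.cube Q) ?_)
      · rw [hvol]
        exact ENNReal.pow_ne_top ENNReal.ofReal_ne_top
      · exact Set.iUnion_subset fun R => R.2.2)
  have huniv : {R : A | ENNReal.ofReal ((2 : ℝ) ^ (-(Q.1 + r))) ^ n ≤ volume (D.cube R.1)}
      = Set.univ := by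
    ext R
    simp only [Set.mem_ofPred_eq, Set.mem_univ, iff_true, hvol]
    rw [R.2.1]
  rw [huniv] at hfin
  exact Set.finite_coe_iff.1 (Set.finite_univ_iff.1 hfin)

/-- `𝒟_r(Q)`: the cubes `R ⊆ Q` of the system with `ℓ(Q) = 2 ^ r ℓ(R)`. -/
def descendants (r : ℕ) (Q : CubeIndex n) : Finset (CubeIndex n) :=
  (D.finite_descendants r Q).toFinset

/-- `f ∈ L^q_loc(μ)`. Every compact set is covered by finitely many cubes of the system and every
cube is bounded, so local integrability may be tested on the cubes. -/
def MemLqLoc (μ : Measure (Fin n → ℝ)) (q : ℝ) (f : (Fin n → ℝ) → ℝ) : Prop :=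
  ∀ Q : CubeIndex n, MemLp f (ENNReal.ofReal q) (μ.restrict (D.cube Q))

/-- The martingale Lipschitz seminorm
`sup_Q μ(Q) ^ (-(1/q + a)) (∫_Q |f - ⟨f⟩_{Q̂}|^q dμ) ^ (1/q)`, with values in `[0, ∞]`. -/
def lipSeminorm (μ : Measure (Fin n → ℝ)) (q a : ℝ) (f : (Fin n → ℝ) → ℝ) : ℝ≥0∞ :=
  ⨆ Q : CubeIndex n,
    (∫⁻ x in D.cube Q, ‖f x - ⨍ y in D.cube (D.parent Q), f y ∂μ‖ₑ ^ q ∂μ) ^ (1 / q) /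
      μ (D.cube Q) ^ (1 / q + a)

/-- `f ∈ Λ_q(a)`. -/
def MemLip (μ : Measure (Fin n → ℝ)) (q a : ℝ) (f : (Fin n → ℝ) → ℝ) : Prop :=
  D.MemLqLoc μ q f ∧ D.lipSeminorm μ q a f < ∞

end DyadicSystem

/-- A Haar system for `μ` along `D`: to every cube `Q` are attached `2ⁿ - 1` functions supported on
`Q`, constant on the dyadic children of `Q`, of mean zero, and all of these together are
orthonormal in `L²(μ)`. (When all cubes have positive finite measure, the functions attached to `Q`
therefore span all mean-zero functions on `Q` that are constant on the children of `Q`.) -/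
structure HaarSystem {n : ℕ} (D : DyadicSystem n) (μ : Measure (Fin n → ℝ)) where
  h : CubeIndex n → Fin (2 ^ n - 1) → (Fin n → ℝ) → ℝ
  support : ∀ Q i x, x ∉ D.cube Q → h Q i x = 0
  const_on_children : ∀ Q i, ∀ R ∈ D.descendants 1 Q, ∃ c : ℝ, ∀ x ∈ D.cube R, h Q i x = c
  integral_eq_zero : ∀ Q i, ∫ x, h Q i x ∂μ = 0
  normalized : ∀ Q i, ∫ x, h Q i x * h Q i x ∂μ = 1
  orthogonal : ∀ Q i R j, (Q, i) ≠ (R, j) → ∫ x, h Q i x * h R j x ∂μ = 0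

namespace HaarSystem

variable {n : ℕ} {D : DyadicSystem n} {μ : Measure (Fin n → ℝ)} (H : HaarSystem D μ)

/-- The balanced condition
`sup_Q sup_{R ∈ 𝒟₁(Q)} (‖h_Q‖_{L¹} ‖h_R‖_{L^∞} + ‖h_Q‖_{L^∞} ‖h_R‖_{L¹}) < ∞`, the supremum being
also over all Haar functions attached to `Q` and to `R`. -/
def Balanced : Prop :=
  (⨆ (Q : CubeIndex n) (R ∈ D.descendants 1 Q) (i : Fin (2 ^ n - 1)) (j : Fin (2 ^ n - 1)),
    (eLpNorm (H.h Q i) 1 μ * eLpNorm (H.h R j) ∞ μ +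
      eLpNorm (H.h Q i) ∞ μ * eLpNorm (H.h R j) 1 μ)) < ∞

/-- Coefficients `α^Q_{R,S}` of a Haar shift; they may also depend on which of the Haar functions
of `R` and of `S` are involved. -/
abbrev Coeff (n : ℕ) : Type :=
  CubeIndex n → CubeIndex n → CubeIndex n → Fin (2 ^ n - 1) → Fin (2 ^ n - 1) → ℝ

/-- The `Q`-th term
`∑_{R ∈ 𝒟_r(Q), S ∈ 𝒟_s(Q)} ∑_{i, j} α^{Q,i,j}_{R,S} ⟨f, h_R^i⟩ h_S^j` of a Haar shift of
complexity `(r, s)`. -/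
def shiftTerm (r s : ℕ) (α : Coeff n) (f : (Fin n → ℝ) → ℝ) (Q : CubeIndex n)
    (x : Fin n → ℝ) : ℝ :=
  ∑ R ∈ D.descendants r Q, ∑ S ∈ D.descendants s Q, ∑ i, ∑ j,
    α Q R S i j * (∫ y, f y * H.h R i y ∂μ) * H.h S j x

/-- The bounded operator `T` on `L²(μ)` is the Haar shift of complexity `(r, s)` with
coefficients `α`: for every `f ∈ L²(μ)` the series of the terms of the shift converges to `T f`
(unconditionally, in `L²(μ)`). -/
def IsShiftOnL2 (r s : ℕ) (α : Coeff n) (T : Lp ℝ 2 μ →L[ℝ] Lp ℝ 2 μ) : Prop :=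
  ∀ f : Lp ℝ 2 μ,
    Tendsto (fun F : Finset (CubeIndex n) =>
      eLpNorm (fun x => (∑ Q ∈ F, H.shiftTerm r s α f Q x) - T f x) 2 μ) atTop (𝓝 0)

/-- `g` is (a representative of) the image `T f` of `f ∈ L^q_loc(μ)` under the Haar shift.
For functions that do not decay the series of the shift converges only up to additive constants:
`T f` is the function `g ∈ L^q_loc(μ)` such that on every cube `P` the series
`∑_Q (t_Q - ⟨t_Q⟩_P)`, `t_Q` being the terms of the shift, converges to `g - ⟨g⟩_P`
(unconditionally, in `L^q(P, μ)`). Terms whose Haar functions live on cubes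
strictly larger than `P` are constant on `P` and drop out. This determines `g`
up to a function that is constant on every cube of the system. -/
def IsShiftImage (r s : ℕ) (α : Coeff n) (q : ℝ) (f g : (Fin n → ℝ) → ℝ) : Prop :=
  D.MemLqLoc μ q g ∧
  ∀ P : CubeIndex n,
    Tendsto (fun F : Finset (CubeIndex n) =>
      eLpNorm (fun x =>
          (∑ Q ∈ F, (H.shiftTerm r s α f Q x - ⨍ y in D.cube P, H.shiftTerm r s α f Q y ∂μ)) -
            (g x - ⨍ y in D.cube P, g y ∂μ))
        (ENNReal.ofReal q) (μ.restrict (D.cube P))) atTop (𝓝 0)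

end HaarSystem

end

/-! Three facts carry the proof. The first is a John–Nirenberg inequality for martingale differences
measured against the parent's average, `lintegral_sub_mean_parent_rpow_le`. Because the parent's
mean is the one subtracted, the stopping argument never compares the measure of a cube with that of
its parent, so no doubling is needed; since $\mu(R)^\alpha\le\mu(P)^\alpha$ for $R\subseteq P$, all
the spaces $\Lambda_p(\alpha)$ with the same $\alpha$ coincide with $\Lambda_1(\alpha)$. This
reduces estimates to $p=2$, where the $L^2$ bound of $T$ applies.

The second is the use of balance. It makes the numbers
$b(Q)\approx\|h_Q\|_{L^1}\approx\|h_Q\|_{L^\infty}^{-1}$ comparable at neighbouring cubes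
(`exists_scale`), although the measures of these cubes need not be. All children of $Q$ but one have
measure $\lesssim b(Q)^2$, and the exceptional child is eliminated by a mean-zero identity; so
$|\langle f,h_Q\rangle|\lesssim b(Q)^{1+2\alpha}\|f\|_{\Lambda_1(\alpha)}$
(`abs_integral_mul_h_le`). As $b(Q)^2\lesssim\mu(Q)$, such a coefficient is dominated by
$\mu(P)^{1/2+\alpha}$ for every $P$ at bounded tree distance.

The third is the locality of a shift. After subtraction of the mean over $\widehat P$, the only
terms left on $P$ are those with $Q\subseteq P$ and at most $s+1$ strict ancestors of $P$. The
coefficients of the former are square-summed by Bessel's inequality for $1_P(f-\langle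
f\rangle_{\widehat P})$, those of the latter by the second fact. A finite part of the shift is $T$
applied to a finite Haar sum, so its $L^2$ norm is at most $\|T\|$ times the $\ell^2$ norm of the
coefficients. This bounds all finite partial sums uniformly on $\Lambda_2(\alpha)$, hence on every
$\Lambda_p(\alpha)$ (`exists_lipSeminorm_sum_shiftTerm_le`).

It remains to pass to the limit. On each cube the series converges in $L^2$ modulo constants,
because there it differs from a subseries of $T\varphi$, $\varphi\in L^2$, by finitely many terms.
The uniform $L^p$ bounds upgrade this to $L^q$, the local limits are glued, and Fatou's lemma
transfers the seminorm bound. -/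

namespace DyadicSystem

variable {n : ℕ} (D : DyadicSystem n)

/-! ### Combinatorics of the dyadic tree -/

theorem eq_of_mem_cube {Q R : CubeIndex n} {x : Fin n → ℝ} (hg : Q.1 = R.1) (hQ : x ∈ D.cube Q)
    (hR : x ∈ D.cube R) : Q = R := by
  obtain ⟨k, j⟩ := Q
  obtain ⟨k', j'⟩ := R
  have hkk : k = k' := hg
  subst hkk
  have := (D.partition k x).unique hQ hR
  subst this
  rfl

theorem cubeAt_eq {Q : CubeIndex n} {x : Fin n → ℝ} (hQ : x ∈ D.cube Q) : D.cubeAt Q.1 x = Q :=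
  D.eq_of_mem_cube rfl (D.mem_cube_cubeAt _ _) hQ

theorem cube_subset_of_mem {Q R : CubeIndex n} {x : Fin n → ℝ} (hg : Q.1 ≤ R.1)
    (hQ : x ∈ D.cube Q) (hR : x ∈ D.cube R) : D.cube R ⊆ D.cube Q := by
  rcases hg.eq_or_lt with h | h
  · rw [D.eq_of_mem_cube h hQ hR]
  rcases D.nested Q R with h1 | h1 | h1
  · exact absurd hR (Set.disjoint_left.1 h1 hQ)
  · intro y _ i hi
    exfalso
    have hp := zpow_pos (two_pos : (0 : ℝ) < 2) (-R.1)
    -- If the larger cube lay inside the smaller one, its corner and that corner translated by the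
    -- smaller side length would both lie in the smaller cube, which is impossible for a half-open
    -- side.
    have hlt : (2 : ℝ) ^ (-R.1) < 2 ^ (-Q.1) := zpow_lt_zpow_right₀ one_lt_two (by omega)
    have hc := h1 (D.corner_mem_cube Q)
    have hz : (fun m => D.corner Q m + (2 : ℝ) ^ (-R.1)) ∈ D.cube R := by
      apply h1
      intro m _
      simp only [Set.mem_Ico]
      constructor <;> linarith
    have e1 := (hc i hi).1
    have e2 := (hz i hi).2
    simp only at e2
    linarith
  · exact h1

theorem disjoint_or_subset {Q R : CubeIndex n} (hg : Q.1 ≤ R.1) :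
    Disjoint (D.cube Q) (D.cube R) ∨ D.cube R ⊆ D.cube Q := by
  by_cases h : Disjoint (D.cube Q) (D.cube R)
  · exact Or.inl h
  · obtain ⟨x, hx1, hx2⟩ := Set.not_disjoint_iff.1 h
    exact Or.inr (D.cube_subset_of_mem hg hx1 hx2)

theorem mem_descendants {r : ℕ} {Q R : CubeIndex n} :
    R ∈ D.descendants r Q ↔ R.1 = Q.1 + r ∧ D.cube R ⊆ D.cube Q := by
  simp [descendants]

theorem cubeAt_mem_descendants (r : ℕ) {Q : CubeIndex n} {x : Fin n → ℝ} (hx : x ∈ D.cube Q) :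
    D.cubeAt (Q.1 + r) x ∈ D.descendants r Q :=
  D.mem_descendants.2 ⟨rfl, D.cube_subset_of_mem (by simp [cubeAt]) hx (D.mem_cube_cubeAt _ _)⟩

theorem descendants_nonempty (r : ℕ) (Q : CubeIndex n) : (D.descendants r Q).Nonempty :=
  ⟨_, D.cubeAt_mem_descendants r (D.corner_mem_cube Q)⟩

theorem cube_eq_biUnion (r : ℕ) (Q : CubeIndex n) :
    D.cube Q = ⋃ R ∈ D.descendants r Q, D.cube R := by
  ext x
  simp only [Set.mem_iUnion, exists_prop]
  constructor
  · intro hx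
    exact ⟨_, D.cubeAt_mem_descendants r hx, D.mem_cube_cubeAt _ _⟩
  · rintro ⟨R, hR, hx⟩
    exact (D.mem_descendants.1 hR).2 hx

theorem pairwiseDisjoint_descendants (r : ℕ) (Q : CubeIndex n) :
    Set.PairwiseDisjoint (↑(D.descendants r Q)) D.cube := by
  intro R hR S hS hne
  refine Set.disjoint_left.2 fun x hx1 hx2 => hne ?_
  exact D.eq_of_mem_cube ((D.mem_descendants.1 hR).1.trans (D.mem_descendants.1 hS).1.symm) hx1 hx2

theorem parent_of_mem_descendants {Q R : CubeIndex n} (hR : R ∈ D.descendants 1 Q) :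
    D.parent R = Q := by
  have h := D.mem_descendants.1 hR
  have : R.1 - 1 = Q.1 := by rw [h.1]; simp
  rw [parent, this]
  exact D.cubeAt_eq (h.2 (D.corner_mem_cube R))

theorem mem_descendants_parent (Q : CubeIndex n) : Q ∈ D.descendants 1 (D.parent Q) :=
  D.mem_descendants.2 ⟨by simp [parent, cubeAt], D.cube_subset_cube_parent Q⟩

theorem volume_cube (R : CubeIndex n) :
    volume (D.cube R) = ENNReal.ofReal ((2 : ℝ) ^ (-R.1)) ^ n := by
  simp [cube, halfOpenCube, volume_pi_pi, Real.volume_Ico]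

theorem measure_cube_eq_sum (ν : Measure (Fin n → ℝ)) (r : ℕ) (Q : CubeIndex n) :
    ν (D.cube Q) = ∑ R ∈ D.descendants r Q, ν (D.cube R) := by
  conv_lhs => rw [D.cube_eq_biUnion r Q]
  exact measure_biUnion_finset (D.pairwiseDisjoint_descendants r Q)
    fun R _ => D.measurableSet_cube R

theorem lintegral_cube_eq_sum (ν : Measure (Fin n → ℝ)) (r : ℕ) (Q : CubeIndex n)
    (F : (Fin n → ℝ) → ℝ≥0∞) :
    ∫⁻ x in D.cube Q, F x ∂ν = ∑ R ∈ D.descendants r Q, ∫⁻ x in D.cube R, F x ∂ν := by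
  conv_lhs => rw [D.cube_eq_biUnion r Q]
  exact lintegral_biUnion_finset (D.pairwiseDisjoint_descendants r Q)
    (fun R _ => D.measurableSet_cube R) _

theorem integral_cube_eq_sum (ν : Measure (Fin n → ℝ)) (r : ℕ) (Q : CubeIndex n)
    {F : (Fin n → ℝ) → ℝ} (hF : IntegrableOn F (D.cube Q) ν) :
    ∫ x in D.cube Q, F x ∂ν = ∑ R ∈ D.descendants r Q, ∫ x in D.cube R, F x ∂ν := by
  conv_lhs => rw [D.cube_eq_biUnion r Q]
  exact integral_biUnion_finset _ (fun R _ => D.measurableSet_cube R)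
    (D.pairwiseDisjoint_descendants r Q) fun R hR => hF.mono_set (D.mem_descendants.1 hR).2

/-- Compare Lebesgue volumes: equal disjoint subcubes fill $Q$. The exact count is what makes the
Haar functions of $Q$ and the constant a full basis on the children. -/
theorem card_descendants (r : ℕ) (Q : CubeIndex n) : (D.descendants r Q).card = 2 ^ (n * r) := by
  have h := D.measure_cube_eq_sum volume r Q
  rw [Finset.sum_congr rfl (g := fun _ => ENNReal.ofReal ((2 : ℝ) ^ (-(Q.1 + r))) ^ n)
    (fun R hR => by rw [D.volume_cube, (D.mem_descendants.1 hR).1]), D.volume_cube,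
    Finset.sum_const, nsmul_eq_mul, ← ENNReal.ofReal_pow (zpow_nonneg two_pos.le _),
    ← ENNReal.ofReal_pow (zpow_nonneg two_pos.le _), ← ENNReal.ofReal_natCast,
    ← ENNReal.ofReal_mul (by positivity),
    ENNReal.ofReal_eq_ofReal_iff (by positivity) (by positivity), neg_add,
    zpow_add₀ two_ne_zero, mul_pow, zpow_neg _ (r : ℤ), zpow_natCast, inv_pow, ← pow_mul] at h
  have h2 : (0 : ℝ) < ((2 : ℝ) ^ (-Q.1)) ^ n := by positivity
  have h3 : (0 : ℝ) < (2 : ℝ) ^ (r * n) := by positivity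
  have h4 : ((D.descendants r Q).card : ℝ) = 2 ^ (r * n) := by
    field_simp at h
    nlinarith
  rw [mul_comm n r]
  exact_mod_cast h4

theorem measurable_cubeAt (k : ℤ) : Measurable (D.cubeAt k) := by
  refine measurable_to_countable' fun Q => ?_
  by_cases h : Q.1 = k
  · convert D.measurableSet_cube Q using 1
    ext x
    constructor
    · rintro rfl
      exact D.mem_cube_cubeAt k x
    · intro hx
      subst h
      exact D.cubeAt_eq hx
  · convert MeasurableSet.empty using 1
    ext x
    simp only [Set.mem_preimage, Set.mem_singleton_iff, Set.mem_empty_iff_false, iff_false]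
    rintro rfl
    exact h rfl

end DyadicSystem

/-! ### Fatou's lemma and layer sums -/

/-- Norm convergence gives convergence in measure, hence almost everywhere along a subsequence, and
Fatou applies. The exponents `e` and `p` are unrelated: convergence in one norm carries bounds in
any other. -/
theorem lintegral_enorm_rpow_le_of_tendsto {Ω ι : Type*} [MeasurableSpace Ω] {ν : Measure Ω}
    {l : Filter ι} [l.NeBot] [l.IsCountablyGenerated] {u : ι → Ω → ℝ} {v : Ω → ℝ}
    (hu : ∀ i, AEStronglyMeasurable (u i) ν) (hv : AEStronglyMeasurable v ν) {e : ℝ≥0∞}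
    (he : e ≠ 0) (h : Tendsto (fun i => eLpNorm (fun x => u i x - v x) e ν) l (𝓝 0))
    {p : ℝ} {B : ℝ≥0∞} (hB : ∀ i, ∫⁻ x, ‖u i x‖ₑ ^ p ∂ν ≤ B) :
    ∫⁻ x, ‖v x‖ₑ ^ p ∂ν ≤ B := by
  obtain ⟨w, hw⟩ := exists_seq_tendsto l
  have h1 : TendstoInMeasure ν (fun m => u (w m)) atTop v :=
    tendstoInMeasure_of_tendsto_eLpNorm he (fun m => hu (w m)) hv (h.comp hw)
  obtain ⟨ns, -, hns⟩ := h1.exists_seq_tendsto_ae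
  have h2 : ∫⁻ x, ‖v x‖ₑ ^ p ∂ν
      = ∫⁻ x, liminf (fun m => ‖u (w (ns m)) x‖ₑ ^ p) atTop ∂ν := by
    refine lintegral_congr_ae ?_
    filter_upwards [hns] with x hx
    have : Tendsto (fun m => ‖u (w (ns m)) x‖ₑ ^ p) atTop (𝓝 (‖v x‖ₑ ^ p)) :=
      (ENNReal.continuous_rpow_const.tendsto _).comp ((continuous_enorm.tendsto _).comp hx)
    exact this.liminf_eq.symm
  rw [h2]
  refine (lintegral_liminf_le' fun m => ((hu _).enorm.pow_const p)).trans ?_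
  exact (liminf_le_liminf (Eventually.of_forall fun m => hB (w (ns m)))).trans (by simp)

/-- The single layer with $jt<y\le(j+1)t$ already dominates the left side. -/
theorem ENNReal.rpow_le_tsum_layers {p : ℝ} (hp : 0 < p) {t : ℝ≥0∞} (ht : t ≠ 0) {y : ℝ≥0∞}
    (hy : y ≠ ∞) :
    y ^ p ≤ ∑' j : ℕ, (((j : ℝ≥0∞) + 1) * t) ^ p * (if (j : ℝ≥0∞) * t < y then 1 else 0) := by
  rcases eq_or_ne y 0 with rfl | hy0
  · simp [ENNReal.zero_rpow_of_pos hp]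
  have hex : ∃ j : ℕ, y ≤ ((j : ℝ≥0∞) + 1) * t := by
    obtain ⟨m, hm⟩ := ENNReal.exists_nat_mul_gt ht hy
    exact ⟨m, hm.le.trans (by gcongr; exact le_self_add)⟩
  classical
  have h1 := Nat.find_spec hex
  set j := Nat.find hex with hj
  have h2 : (j : ℝ≥0∞) * t < y := by
    rcases Nat.eq_zero_or_pos j with h0 | h0
    · simp [h0, pos_iff_ne_zero, hy0]
    · have := Nat.find_min hex (m := j - 1) (by omega)
      have hc : ((j - 1 : ℕ) : ℝ≥0∞) + 1 = j := by
        exact_mod_cast Nat.sub_add_cancel h0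
      rw [hc] at this
      exact not_le.1 this
  refine le_trans ?_ (ENNReal.le_tsum j)
  simp only [h2, if_true, mul_one]
  exact ENNReal.rpow_le_rpow h1 hp.le

theorem ENNReal.tsum_rpow_mul_geometric_lt_top (p : ℝ) :
    ∑' j : ℕ, ((j : ℝ≥0∞) + 1) ^ p * 2⁻¹ ^ j < ∞ := by
  obtain ⟨k, hk⟩ := exists_nat_ge p
  have h1 : Summable fun j : ℕ => ((j : ℝ) + 1) ^ k * (2⁻¹ : ℝ) ^ (j + 1) := by
    have := summable_pow_mul_geometric_of_norm_lt_one (R := ℝ) k (r := 2⁻¹) (by norm_num)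
    simpa using (summable_nat_add_iff 1).2 this
  have h2 : ∀ j : ℕ, ((j : ℝ≥0∞) + 1) ^ p * 2⁻¹ ^ j
      ≤ 2 * ENNReal.ofReal (((j : ℝ) + 1) ^ k * (2⁻¹ : ℝ) ^ (j + 1)) := by
    intro j
    have e1 : ENNReal.ofReal (((j : ℝ) + 1) ^ k * (2⁻¹ : ℝ) ^ (j + 1))
        = ((j : ℝ≥0∞) + 1) ^ k * 2⁻¹ ^ (j + 1) := by
      rw [ENNReal.ofReal_mul (by positivity), ENNReal.ofReal_pow (by positivity),
        ENNReal.ofReal_pow (by positivity), ENNReal.ofReal_add (by positivity) zero_le_one,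
        ENNReal.ofReal_natCast, ENNReal.ofReal_one, ENNReal.ofReal_inv_of_pos two_pos,
        ENNReal.ofReal_ofNat]
    have e2 : 2 * (((j : ℝ≥0∞) + 1) ^ k * 2⁻¹ ^ (j + 1)) = ((j : ℝ≥0∞) + 1) ^ k * 2⁻¹ ^ j := by
      rw [pow_succ]
      calc _ = (((j : ℝ≥0∞) + 1) ^ k * 2⁻¹ ^ j) * (2⁻¹ * 2) := by ring
        _ = _ := by rw [ENNReal.inv_mul_cancel two_ne_zero ENNReal.ofNat_ne_top, mul_one]
    rw [e1, e2]
    gcongr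
    rw [← ENNReal.rpow_natCast]
    exact ENNReal.rpow_le_rpow_of_exponent_le le_add_self hk
  refine (ENNReal.tsum_le_tsum h2).trans_lt ?_
  rw [ENNReal.tsum_mul_left, ← ENNReal.ofReal_tsum_of_nonneg (fun j => by positivity) h1]
  exact ENNReal.mul_lt_top ENNReal.ofNat_lt_top ENNReal.ofReal_lt_top

/-! ### The dyadic John–Nirenberg inequality -/

namespace DyadicSystem

variable {n : ℕ} (D : DyadicSystem n) (μ : Measure (Fin n → ℝ))

/-- The mean `⟨f⟩_Q`. -/
noncomputable abbrev mean (f : (Fin n → ℝ) → ℝ) (Q : CubeIndex n) : ℝ := ⨍ y in D.cube Q, f y ∂μ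

/-- All cubes of the system have positive and finite measure. -/
abbrev IsNondegenerate : Prop := ∀ Q : CubeIndex n, 0 < μ (D.cube Q) ∧ μ (D.cube Q) < ∞

variable {D μ}

theorem measureReal_cube_pos (hμ : D.IsNondegenerate μ) (Q : CubeIndex n) : 0 < μ.real (D.cube Q) :=
  ENNReal.toReal_pos (hμ Q).1.ne' (hμ Q).2.ne

theorem isFiniteMeasure_restrict_cube (hμ : D.IsNondegenerate μ) (Q : CubeIndex n) :
    IsFiniteMeasure (μ.restrict (D.cube Q)) :=
  ⟨by simpa using (hμ Q).2⟩

theorem integrableOn_const_cube (hμ : D.IsNondegenerate μ) (Q : CubeIndex n) (c : ℝ) :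
    IntegrableOn (fun _ => c) (D.cube Q) μ :=
  integrableOn_const (hμ Q).2.ne

theorem mean_sub_mul (hμ : D.IsNondegenerate μ)
    {f : (Fin n → ℝ) → ℝ} {Q : CubeIndex n} (hf : IntegrableOn f (D.cube Q) μ)
    (c : ℝ) : (D.mean μ f Q - c) * μ.real (D.cube Q) = ∫ x in D.cube Q, (f x - c) ∂μ := by
  rw [integral_sub hf (integrableOn_const_cube hμ Q c), setIntegral_const, mean, setAverage_eq,
    smul_eq_mul, smul_eq_mul]
  have := (measureReal_cube_pos hμ Q).ne'
  field_simp

theorem mean_mul (hμ : D.IsNondegenerate μ) {f : (Fin n → ℝ) → ℝ} {Q : CubeIndex n} :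
    D.mean μ f Q * μ.real (D.cube Q) = ∫ x in D.cube Q, f x ∂μ := by
  rw [mean, setAverage_eq, smul_eq_mul]
  have := (measureReal_cube_pos hμ Q).ne'
  field_simp

theorem enorm_mean_sub_mul_le (hμ : D.IsNondegenerate μ) {f : (Fin n → ℝ) → ℝ} {Q : CubeIndex n}
    (hf : IntegrableOn f (D.cube Q) μ) (c : ℝ) :
    ‖D.mean μ f Q - c‖ₑ * μ (D.cube Q) ≤ ∫⁻ x in D.cube Q, ‖f x - c‖ₑ ∂μ := by
  have h : μ (D.cube Q) = ‖μ.real (D.cube Q)‖ₑ := by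
    rw [Real.enorm_eq_ofReal measureReal_nonneg, ofReal_measureReal (hμ Q).2.ne]
  rw [h, ← enorm_mul, mean_sub_mul hμ hf]
  exact enorm_integral_le_lintegral_enorm _

variable (D μ) in
/-- The mass of the maximal cubes `R ⊆ Q`, among those at most `m` generations below `Q`, for which
`|⟨f⟩_R - c| > t`. -/
noncomputable def stoppedMass (f : (Fin n → ℝ) → ℝ) (c : ℝ) (t : ℝ≥0∞) :
    ℕ → CubeIndex n → ℝ≥0∞
  | 0, Q => if t < ‖D.mean μ f Q - c‖ₑ then μ (D.cube Q) else 0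
  | m + 1, Q => if t < ‖D.mean μ f Q - c‖ₑ then μ (D.cube Q) else
      ∑ R ∈ D.descendants 1 Q, stoppedMass f c t m R

theorem stoppedMass_of_lt {f : (Fin n → ℝ) → ℝ} {c : ℝ} {t : ℝ≥0∞} (m : ℕ) {Q : CubeIndex n}
    (h : t < ‖D.mean μ f Q - c‖ₑ) : D.stoppedMass μ f c t m Q = μ (D.cube Q) := by
  cases m <;> simp [stoppedMass, h]

theorem stoppedMass_le (f : (Fin n → ℝ) → ℝ) (c : ℝ) (t : ℝ≥0∞) (m : ℕ) (Q : CubeIndex n) :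
    D.stoppedMass μ f c t m Q ≤ μ (D.cube Q) := by
  induction m generalizing Q with
  | zero => simp only [stoppedMass]; split_ifs <;> simp
  | succ m ih =>
    simp only [stoppedMass]
    split_ifs
    · exact le_rfl
    · rw [D.measure_cube_eq_sum μ 1 Q]
      exact Finset.sum_le_sum fun R _ => ih R

/-- By the triangle inequality, a cube stopped around `c` at level `s + t` is also past level `t`
around `c'`, so the second family stops no later. -/
theorem stoppedMass_add_le (f : (Fin n → ℝ) → ℝ) {c c' : ℝ} {s : ℝ≥0∞} (t : ℝ≥0∞)
    (hc : ‖c' - c‖ₑ ≤ s) (m : ℕ) (Q : CubeIndex n) :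
    D.stoppedMass μ f c (s + t) m Q ≤ D.stoppedMass μ f c' t m Q := by
  have key : ∀ Q, s + t < ‖D.mean μ f Q - c‖ₑ → t < ‖D.mean μ f Q - c'‖ₑ := by
    intro Q h
    by_contra! h'
    refine absurd h (not_lt.2 ?_)
    calc ‖D.mean μ f Q - c‖ₑ = ‖(c' - c) + (D.mean μ f Q - c')‖ₑ := by congr 1; ring
      _ ≤ ‖c' - c‖ₑ + ‖D.mean μ f Q - c'‖ₑ := enorm_add_le _ _
      _ ≤ s + t := add_le_add hc h'
  induction m generalizing Q with
  | zero =>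
    by_cases h : s + t < ‖D.mean μ f Q - c‖ₑ
    · rw [stoppedMass_of_lt _ h, stoppedMass_of_lt _ (key Q h)]
    · simp [stoppedMass, h]
  | succ m ih =>
    by_cases h' : t < ‖D.mean μ f Q - c'‖ₑ
    · rw [stoppedMass_of_lt _ h']
      exact stoppedMass_le ..
    · have h : ¬ s + t < ‖D.mean μ f Q - c‖ₑ := fun h => h' (key Q h)
      simp only [stoppedMass, h, h', if_false]
      exact Finset.sum_le_sum fun R _ => ih R

/-- Chebyshev's inequality on each stopped cube, summed over these disjoint cubes. -/
theorem mul_stoppedMass_le (hμ : D.IsNondegenerate μ)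
    {f : (Fin n → ℝ) → ℝ} (hf : ∀ Q, IntegrableOn f (D.cube Q) μ) (c : ℝ)
    (t : ℝ≥0∞) (m : ℕ) (Q : CubeIndex n) :
    t * D.stoppedMass μ f c t m Q ≤ ∫⁻ x in D.cube Q, ‖f x - c‖ₑ ∂μ := by
  have key : ∀ m Q, t < ‖D.mean μ f Q - c‖ₑ →
      t * D.stoppedMass μ f c t m Q ≤ ∫⁻ x in D.cube Q, ‖f x - c‖ₑ ∂μ := by
    intro m Q h
    rw [stoppedMass_of_lt _ h]
    refine le_trans ?_ (enorm_mean_sub_mul_le hμ (hf Q) c)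
    gcongr
  induction m generalizing Q with
  | zero =>
    by_cases h : t < ‖D.mean μ f Q - c‖ₑ
    · exact key _ _ h
    · simp [stoppedMass, h]
  | succ m ih =>
    by_cases h : t < ‖D.mean μ f Q - c‖ₑ
    · exact key _ _ h
    · simp only [stoppedMass, h, if_false]
      rw [Finset.mul_sum, D.lintegral_cube_eq_sum μ 1 Q]
      exact Finset.sum_le_sum fun R _ => ih R

/-- The good-λ step. On a cube that stops at level `s`, the parent's mean is still within `s` of
`c`; recentring at that mean costs `s` and leaves level `t`, where the weak-type bound and `hA`
apply. When `Q` does not stop, its own mean supplies the hypothesis on the parent's mean for its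
children. -/
theorem mul_stoppedMass_add_le (hμ : D.IsNondegenerate μ)
    {f : (Fin n → ℝ) → ℝ} (hf : ∀ Q, IntegrableOn f (D.cube Q) μ)
    {P : CubeIndex n} {A : ℝ≥0∞}
    (hA : ∀ R, D.cube R ⊆ D.cube P →
      ∫⁻ x in D.cube R, ‖f x - D.mean μ f (D.parent R)‖ₑ ∂μ ≤ A * μ (D.cube R))
    {c : ℝ} {s : ℝ≥0∞} (t : ℝ≥0∞) (m : ℕ) {Q : CubeIndex n} (hQ : D.cube Q ⊆ D.cube P)
    (hc : ‖D.mean μ f (D.parent Q) - c‖ₑ ≤ s) :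
    t * D.stoppedMass μ f c (s + t) m Q ≤ A * D.stoppedMass μ f c s m Q := by
  have key : ∀ m Q, D.cube Q ⊆ D.cube P → ‖D.mean μ f (D.parent Q) - c‖ₑ ≤ s →
      s < ‖D.mean μ f Q - c‖ₑ →
      t * D.stoppedMass μ f c (s + t) m Q ≤ A * D.stoppedMass μ f c s m Q := by
    intro m Q hQ hc h
    rw [stoppedMass_of_lt _ h]
    calc t * D.stoppedMass μ f c (s + t) m Q
        ≤ t * D.stoppedMass μ f (D.mean μ f (D.parent Q)) t m Q := by
          gcongr; exact stoppedMass_add_le f t hc m Q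
      _ ≤ _ := mul_stoppedMass_le hμ hf _ t m Q
      _ ≤ _ := hA Q hQ
  induction m generalizing Q with
  | zero =>
    by_cases h : s < ‖D.mean μ f Q - c‖ₑ
    · exact key _ _ hQ hc h
    · have h' : ¬ s + t < ‖D.mean μ f Q - c‖ₑ := fun h' => h (le_self_add.trans_lt h')
      simp [stoppedMass, h']
  | succ m ih =>
    by_cases h : s < ‖D.mean μ f Q - c‖ₑ
    · exact key _ _ hQ hc h
    · have h' : ¬ s + t < ‖D.mean μ f Q - c‖ₑ := fun h' => h (le_self_add.trans_lt h')
      simp only [stoppedMass, h, h', if_false]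
      rw [Finset.mul_sum, Finset.mul_sum]
      refine Finset.sum_le_sum fun R hR => ih ((D.mem_descendants.1 hR).2.trans hQ) ?_
      rw [D.parent_of_mem_descendants hR]
      exact not_lt.1 h

/-- If the mean at depth `m` above `x` is past the level, that cube or one of its ancestors inside
`Q` has been stopped, so the stopped cubes cover the superlevel set. -/
theorem measure_lt_mean_cubeAt_le_stoppedMass (f : (Fin n → ℝ) → ℝ) (c : ℝ) (t : ℝ≥0∞) (m : ℕ)
    (Q : CubeIndex n) :
    μ.restrict (D.cube Q) {x | t < ‖D.mean μ f (D.cubeAt (Q.1 + m) x) - c‖ₑ}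
      ≤ D.stoppedMass μ f c t m Q := by
  induction m generalizing Q with
  | zero =>
    by_cases h : t < ‖D.mean μ f Q - c‖ₑ
    · rw [stoppedMass_of_lt _ h]
      exact (measure_mono (Set.subset_univ _)).trans (by simp)
    · rw [Measure.restrict_apply' (D.measurableSet_cube Q)]
      refine le_of_eq_of_le ?_ zero_le
      convert measure_empty (μ := μ)
      ext x
      simp only [Set.mem_inter_iff, Set.mem_ofPred_eq, Set.mem_empty_iff_false, iff_false, not_and]
      intro hx hxQ
      simp only [Nat.cast_zero, add_zero, D.cubeAt_eq hxQ] at hx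
      exact h hx
  | succ m ih =>
    by_cases h : t < ‖D.mean μ f Q - c‖ₑ
    · rw [stoppedMass_of_lt _ h]
      exact (measure_mono (Set.subset_univ _)).trans (by simp)
    · simp only [stoppedMass, h, if_false]
      have e : μ.restrict (D.cube Q) {x | t < ‖D.mean μ f (D.cubeAt (Q.1 + (m + 1 : ℕ)) x) - c‖ₑ}
          ≤ ∑ R ∈ D.descendants 1 Q, μ.restrict (D.cube R)
            {x | t < ‖D.mean μ f (D.cubeAt (Q.1 + (m + 1 : ℕ)) x) - c‖ₑ} := by
        rw [Measure.restrict_apply' (D.measurableSet_cube Q)]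
        simp_rw [fun R => Measure.restrict_apply' (μ := μ)
          (t := {x | t < ‖D.mean μ f (D.cubeAt (Q.1 + (m + 1 : ℕ)) x) - c‖ₑ})
          (D.measurableSet_cube R)]
        refine le_trans (measure_mono ?_) (measure_biUnion_finset_le _ _)
        conv_lhs => rw [D.cube_eq_biUnion 1 Q]
        rw [Set.inter_iUnion₂]
      refine e.trans (Finset.sum_le_sum fun R hR => le_trans (le_of_eq ?_) (ih R))
      have : Q.1 + ((m + 1 : ℕ) : ℤ) = R.1 + m := by
        rw [(D.mem_descendants.1 hR).1]; push_cast; ring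
      rw [this]

theorem lintegral_mean_cubeAt_sub_rpow_le (hμ : D.IsNondegenerate μ) {f : (Fin n → ℝ) → ℝ}
    (hf : ∀ Q, IntegrableOn f (D.cube Q) μ) {P : CubeIndex n} {A : ℝ≥0∞} (hA0 : A ≠ 0)
    (hA1 : A ≠ ∞)
    (hA : ∀ R, D.cube R ⊆ D.cube P →
      ∫⁻ x in D.cube R, ‖f x - D.mean μ f (D.parent R)‖ₑ ∂μ ≤ A * μ (D.cube R))
    {p : ℝ} (hp : 0 < p) (m : ℕ) :
    ∫⁻ x in D.cube P, ‖D.mean μ f (D.cubeAt (P.1 + m) x) - D.mean μ f (D.parent P)‖ₑ ^ p ∂μ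
      ≤ (∑' j : ℕ, ((j : ℝ≥0∞) + 1) ^ p * 2⁻¹ ^ j) * (2 * A) ^ p * μ (D.cube P) := by
  set c := D.mean μ f (D.parent P)
  -- Levels advance by $2A$, so the good-λ step loses a factor $A/(2A)=1/2$ each time; cancelling
  -- $A$ requires it to be nonzero and finite.
  have hdecay : ∀ j : ℕ, D.stoppedMass μ f c (j * (2 * A)) m P ≤ 2⁻¹ ^ j * μ (D.cube P) := by
    intro j
    induction j with
    | zero => simpa using stoppedMass_le (D := D) (μ := μ) f c _ m P
    | succ j ih =>
      have h := mul_stoppedMass_add_le hμ hf hA (c := c) (s := j * (2 * A)) (2 * A) m subset_rfl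
        (by simp [c])
      have e : ((j + 1 : ℕ) : ℝ≥0∞) * (2 * A) = j * (2 * A) + 2 * A := by push_cast; ring
      rw [e]
      rw [mul_comm 2 A, mul_assoc A] at h
      have h' := (ENNReal.mul_le_mul_iff_right hA0 hA1).1 h
      rw [mul_comm A 2] at h'
      generalize D.stoppedMass μ f c (j * (2 * A) + 2 * A) m P = y at h' ⊢
      calc y = 2⁻¹ * (2 * y) := by
            rw [← mul_assoc, ENNReal.inv_mul_cancel two_ne_zero ENNReal.ofNat_ne_top, one_mul]
        _ ≤ 2⁻¹ * (2⁻¹ ^ j * μ (D.cube P)) := mul_le_mul_right (h'.trans ih) _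
        _ = _ := by rw [pow_succ]; ring
  have hmeas : Measurable fun x => ‖D.mean μ f (D.cubeAt (P.1 + m) x) - c‖ₑ :=
    (measurable_of_countable fun Q => ‖D.mean μ f Q - c‖ₑ).comp (D.measurable_cubeAt _)
  calc ∫⁻ x in D.cube P, ‖D.mean μ f (D.cubeAt (P.1 + m) x) - c‖ₑ ^ p ∂μ
      ≤ ∫⁻ x in D.cube P, ∑' j : ℕ, (((j : ℝ≥0∞) + 1) * (2 * A)) ^ p *
          {x | (j : ℝ≥0∞) * (2 * A) < ‖D.mean μ f (D.cubeAt (P.1 + m) x) - c‖ₑ}.indicator 1 x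
            ∂μ := by
        refine lintegral_mono fun x => ?_
        refine (ENNReal.rpow_le_tsum_layers hp (mul_ne_zero two_ne_zero hA0)
          enorm_ne_top).trans (ENNReal.tsum_le_tsum fun j => ?_)
        simp [Set.indicator_apply]
    _ = ∑' j : ℕ, (((j : ℝ≥0∞) + 1) * (2 * A)) ^ p * μ.restrict (D.cube P)
          {x | (j : ℝ≥0∞) * (2 * A) < ‖D.mean μ f (D.cubeAt (P.1 + m) x) - c‖ₑ} := by
        have hs : ∀ j : ℕ, MeasurableSet
            {x | (j : ℝ≥0∞) * (2 * A) < ‖D.mean μ f (D.cubeAt (P.1 + m) x) - c‖ₑ} :=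
          fun j => measurableSet_lt measurable_const hmeas
        rw [lintegral_tsum fun j => ((measurable_one.indicator (hs j)).const_mul _).aemeasurable]
        refine tsum_congr fun j => ?_
        rw [lintegral_const_mul _ (measurable_one.indicator (hs j)), lintegral_indicator_one (hs j)]
    _ ≤ ∑' j : ℕ, (((j : ℝ≥0∞) + 1) * (2 * A)) ^ p * (2⁻¹ ^ j * μ (D.cube P)) := by
        gcongr with j
        exact (measure_lt_mean_cubeAt_le_stoppedMass f c _ m P).trans (hdecay j)
    _ = _ := by
        rw [← ENNReal.tsum_mul_right, ← ENNReal.tsum_mul_right]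
        refine tsum_congr fun j => ?_
        rw [ENNReal.mul_rpow_of_nonneg _ _ hp.le]
        ring

theorem dist_le_of_mem_cube {R : CubeIndex n} {x y : Fin n → ℝ} (hx : x ∈ D.cube R)
    (hy : y ∈ D.cube R) : dist x y ≤ (2 : ℝ) ^ (-R.1) := by
  refine (dist_pi_le_iff (by positivity)).2 fun i => ?_
  have h1 := hx i (Set.mem_univ i)
  have h2 := hy i (Set.mem_univ i)
  rw [Real.dist_eq, abs_le]
  constructor <;> linarith [h1.1, h1.2, h2.1, h2.2]

/-- Dyadic averaging contracts $L^1$ on each cube, so `f` may be replaced by a continuous compactly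
supported function, which is uniformly continuous while side lengths shrink to zero. -/
theorem tendsto_lintegral_mean_cubeAt_sub (hμ : D.IsNondegenerate μ) {f : (Fin n → ℝ) → ℝ}
    (hf : ∀ Q, IntegrableOn f (D.cube Q) μ) (P : CubeIndex n) :
    Tendsto (fun m : ℕ => ∫⁻ x in D.cube P, ‖D.mean μ f (D.cubeAt (P.1 + m) x) - f x‖ₑ ∂μ)
      atTop (𝓝 0) := by
  have := isFiniteMeasure_restrict_cube hμ P
  rw [ENNReal.tendsto_nhds_zero]
  intro ε hε
  -- The final error is $2\delta$, from $f-g$ and its averages, plus $\delta\mu(P)$ from the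
  -- oscillation of $g$.
  obtain ⟨δ, hδ0, hδ⟩ : ∃ δ : ℝ, 0 < δ ∧ ENNReal.ofReal δ * (2 + μ (D.cube P)) ≤ ε := by
    rcases eq_or_ne ε ∞ with rfl | hε'
    · exact ⟨1, one_pos, le_top⟩
    have hM : 2 + μ (D.cube P) ≠ ∞ := ENNReal.add_ne_top.2 ⟨by simp, (hμ P).2.ne⟩
    refine ⟨(ε / (2 + μ (D.cube P))).toReal, ENNReal.toReal_pos ?_ ?_, ?_⟩
    · exact (ENNReal.div_pos hε.ne' hM).ne'
    · exact (ENNReal.div_lt_top hε' (by simp)).ne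
    · rw [ENNReal.ofReal_toReal (ENNReal.div_lt_top hε' (by simp)).ne]
      exact (ENNReal.div_mul_cancel (by simp) hM).le
  obtain ⟨g, hgs, hfg, hgc, hg⟩ := (memLp_one_iff_integrable.2 (hf P)
    ).exists_hasCompactSupport_eLpNorm_sub_le ENNReal.one_ne_top
      (ENNReal.ofReal_pos.2 hδ0).ne'
  rw [eLpNorm_one_eq_lintegral_enorm] at hfg
  have hgP : IntegrableOn g (D.cube P) μ := memLp_one_iff_integrable.1 hg
  obtain ⟨η, hη, hunif⟩ := Metric.uniformContinuous_iff.1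
    (hgs.uniformContinuous_of_continuous hgc) δ hδ0
  have hev : ∀ᶠ m : ℕ in atTop, (2 : ℝ) ^ (-(P.1 + (m : ℤ))) < η := by
    have h1 : Tendsto (fun m : ℕ => (2 : ℝ) ^ (-P.1) * (2⁻¹ : ℝ) ^ m) atTop
        (𝓝 ((2 : ℝ) ^ (-P.1) * 0)) :=
      (tendsto_pow_atTop_nhds_zero_of_lt_one (by norm_num) (by norm_num)).const_mul _
    rw [mul_zero] at h1
    filter_upwards [h1.eventually (gt_mem_nhds hη)] with m hm
    rwa [neg_add, zpow_add₀ two_ne_zero, zpow_neg _ (m : ℤ), zpow_natCast, ← inv_pow]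
  filter_upwards [hev] with m hm
  have hloc : ∀ R ∈ D.descendants m P,
      ∫⁻ x in D.cube R, ‖D.mean μ f (D.cubeAt (P.1 + m) x) - f x‖ₑ ∂μ
        ≤ ENNReal.ofReal δ * μ (D.cube R) + 2 * ∫⁻ x in D.cube R, ‖(f - g) x‖ₑ ∂μ := by
    intro R hR
    obtain ⟨hR1, hR2⟩ := D.mem_descendants.1 hR
    have hgR := hgP.mono_set hR2
    have hpt : ∀ x ∈ D.cube R, ‖D.mean μ f (D.cubeAt (P.1 + m) x) - f x‖ₑ
        ≤ (‖D.mean μ (fun y => f y - g y) R - 0‖ₑ + ENNReal.ofReal δ) + ‖(f - g) x‖ₑ := by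
      intro x hx
      have e1 : D.cubeAt (P.1 + m) x = R := by rw [← hR1]; exact D.cubeAt_eq hx
      have e2 : D.mean μ (fun y => f y - g y) R = D.mean μ f R - D.mean μ g R := by
        simp only [mean, setAverage_eq]
        rw [integral_sub (hf R) hgR, smul_sub]
      have e3 : ‖D.mean μ g R - g x‖ₑ ≤ ENNReal.ofReal δ := by
        have h1 : ‖D.mean μ g R - g x‖ₑ * μ (D.cube R) ≤ ENNReal.ofReal δ * μ (D.cube R) := by
          refine (enorm_mean_sub_mul_le hμ hgR (g x)).trans ?_
          rw [← setLIntegral_const]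
          refine setLIntegral_mono measurable_const fun y hy => ?_
          rw [← ofReal_norm, ← dist_eq_norm]
          refine ENNReal.ofReal_le_ofReal (hunif (lt_of_le_of_lt (dist_le_of_mem_cube hy hx) ?_)).le
          rwa [hR1]
        exact (ENNReal.mul_le_mul_iff_left (hμ R).1.ne' (hμ R).2.ne).1 h1
      rw [e1, sub_zero, e2]
      calc ‖D.mean μ f R - f x‖ₑ
          = ‖((D.mean μ f R - D.mean μ g R) + (D.mean μ g R - g x)) + -((f - g) x)‖ₑ := by
            congr 1; simp only [Pi.sub_apply]; ring
        _ ≤ ‖(D.mean μ f R - D.mean μ g R) + (D.mean μ g R - g x)‖ₑ + ‖-((f - g) x)‖ₑ :=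
            enorm_add_le _ _
        _ ≤ _ := by
            rw [enorm_neg]
            gcongr
            exact (enorm_add_le _ _).trans (by gcongr)
    have h_int : IntegrableOn (fun y => f y - g y) (D.cube R) μ := (hf R).sub hgR
    calc ∫⁻ x in D.cube R, ‖D.mean μ f (D.cubeAt (P.1 + m) x) - f x‖ₑ ∂μ
        ≤ ∫⁻ x in D.cube R, ((‖D.mean μ (fun y => f y - g y) R - 0‖ₑ + ENNReal.ofReal δ)
            + ‖(f - g) x‖ₑ) ∂μ := setLIntegral_mono' (D.measurableSet_cube R) hpt
      _ = (‖D.mean μ (fun y => f y - g y) R - 0‖ₑ * μ (D.cube R)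
            + ENNReal.ofReal δ * μ (D.cube R)) + ∫⁻ x in D.cube R, ‖(f - g) x‖ₑ ∂μ := by
          rw [lintegral_add_left measurable_const, setLIntegral_const, add_mul]
      _ ≤ (∫⁻ x in D.cube R, ‖(f - g) x‖ₑ ∂μ
            + ENNReal.ofReal δ * μ (D.cube R)) + ∫⁻ x in D.cube R, ‖(f - g) x‖ₑ ∂μ := by
          gcongr
          simpa using enorm_mean_sub_mul_le hμ h_int 0
      _ = _ := by ring
  calc ∫⁻ x in D.cube P, ‖D.mean μ f (D.cubeAt (P.1 + m) x) - f x‖ₑ ∂μ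
      ≤ ∑ R ∈ D.descendants m P,
          (ENNReal.ofReal δ * μ (D.cube R) + 2 * ∫⁻ x in D.cube R, ‖(f - g) x‖ₑ ∂μ) := by
        rw [D.lintegral_cube_eq_sum μ m P]
        exact Finset.sum_le_sum hloc
    _ = ENNReal.ofReal δ * μ (D.cube P) + 2 * ∫⁻ x in D.cube P, ‖(f - g) x‖ₑ ∂μ := by
        rw [Finset.sum_add_distrib, ← Finset.mul_sum, ← Finset.mul_sum,
          ← D.measure_cube_eq_sum, ← D.lintegral_cube_eq_sum]
    _ ≤ ENNReal.ofReal δ * μ (D.cube P) + 2 * ENNReal.ofReal δ := by gcongr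
    _ = ENNReal.ofReal δ * (2 + μ (D.cube P)) := by ring
    _ ≤ ε := hδ

/-- The John–Nirenberg inequality on a dyadic cube, for a measure that need not be doubling. -/
theorem lintegral_sub_mean_parent_rpow_le (hμ : D.IsNondegenerate μ) {f : (Fin n → ℝ) → ℝ}
    (hf : ∀ Q, IntegrableOn f (D.cube Q) μ) {P : CubeIndex n} {A : ℝ≥0∞} (hA0 : A ≠ 0)
    (hA1 : A ≠ ∞)
    (hA : ∀ R, D.cube R ⊆ D.cube P →
      ∫⁻ x in D.cube R, ‖f x - D.mean μ f (D.parent R)‖ₑ ∂μ ≤ A * μ (D.cube R))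
    {p : ℝ} (hp : 0 < p) :
    ∫⁻ x in D.cube P, ‖f x - D.mean μ f (D.parent P)‖ₑ ^ p ∂μ
      ≤ (∑' j : ℕ, ((j : ℝ≥0∞) + 1) ^ p * 2⁻¹ ^ j) * (2 * A) ^ p * μ (D.cube P) := by
  -- The truncated inequality is uniform in the depth `m`; the means converge in $L^1$, and Fatou
  -- carries the $L^p$ bound to `f`.
  refine lintegral_enorm_rpow_le_of_tendsto (l := atTop) (e := 1)
    (u := fun (m : ℕ) x => D.mean μ f (D.cubeAt (P.1 + m) x) - D.mean μ f (D.parent P))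
    (fun m => ?_) ((hf P).aestronglyMeasurable.sub aestronglyMeasurable_const) one_ne_zero ?_
    (fun m => lintegral_mean_cubeAt_sub_rpow_le hμ hf hA0 hA1 hA hp m)
  · exact ((measurable_of_countable fun Q => D.mean μ f Q - D.mean μ f (D.parent P)).comp
      (D.measurable_cubeAt _)).aestronglyMeasurable
  · simp only [eLpNorm_one_eq_lintegral_enorm, Pi.sub_apply, sub_sub_sub_cancel_right]
    exact tendsto_lintegral_mean_cubeAt_sub hμ hf P

end DyadicSystem

/-! ### Comparison of the Lipschitz seminorms for different exponents -/

namespace DyadicSystem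

variable {n : ℕ} {D : DyadicSystem n} {μ : Measure (Fin n → ℝ)}

theorem lipSeminorm_le_iff (hμ : D.IsNondegenerate μ) {q a : ℝ} {f : (Fin n → ℝ) → ℝ}
    {L : ℝ≥0∞} :
    D.lipSeminorm μ q a f ≤ L ↔ ∀ Q : CubeIndex n,
      (∫⁻ x in D.cube Q, ‖f x - D.mean μ f (D.parent Q)‖ₑ ^ q ∂μ) ^ (1 / q)
        ≤ L * μ (D.cube Q) ^ (1 / q + a) := by
  simp only [lipSeminorm, iSup_le_iff]
  refine forall_congr' fun Q => ?_
  rw [ENNReal.div_le_iff]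
  · exact (ENNReal.rpow_pos (hμ Q).1 (hμ Q).2.ne).ne'
  · exact ENNReal.rpow_ne_top_of_ne_zero (hμ Q).1.ne' (hμ Q).2.ne

theorem rpow_lintegral_le_lipSeminorm (hμ : D.IsNondegenerate μ) (q a : ℝ)
    (f : (Fin n → ℝ) → ℝ) (Q : CubeIndex n) :
    (∫⁻ x in D.cube Q, ‖f x - D.mean μ f (D.parent Q)‖ₑ ^ q ∂μ) ^ (1 / q)
      ≤ D.lipSeminorm μ q a f * μ (D.cube Q) ^ (1 / q + a) :=
  (lipSeminorm_le_iff hμ).1 le_rfl Q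

theorem lintegral_le_lipSeminorm_one (hμ : D.IsNondegenerate μ) (a : ℝ)
    (f : (Fin n → ℝ) → ℝ) (Q : CubeIndex n) :
    ∫⁻ x in D.cube Q, ‖f x - D.mean μ f (D.parent Q)‖ₑ ∂μ
      ≤ D.lipSeminorm μ 1 a f * μ (D.cube Q) ^ a * μ (D.cube Q) := by
  have := rpow_lintegral_le_lipSeminorm hμ 1 a f Q
  simp only [ENNReal.rpow_one, div_one] at this
  refine this.trans (le_of_eq ?_)
  rw [ENNReal.rpow_add _ _ (hμ Q).1.ne' (hμ Q).2.ne, ENNReal.rpow_one]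
  ring

/-- Hölder's inequality on each cube; its factor $\mu(Q)^{1/p-1/q}$ is absorbed exactly by the
normalisation. -/
theorem lipSeminorm_mono_exponent (hμ : D.IsNondegenerate μ) {p q : ℝ} (hp : 0 < p) (hpq : p ≤ q)
    (a : ℝ) {f : (Fin n → ℝ) → ℝ} (hf : ∀ Q, IntegrableOn f (D.cube Q) μ) :
    D.lipSeminorm μ p a f ≤ D.lipSeminorm μ q a f := by
  rw [lipSeminorm_le_iff hμ]
  intro Q
  have h := eLpNorm'_le_eLpNorm'_mul_rpow_measure_univ hp hpq
    ((hf Q).aestronglyMeasurable.sub (aestronglyMeasurable_const (b := D.mean μ f (D.parent Q))))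
  simp only [eLpNorm', Measure.restrict_apply_univ, Pi.sub_apply] at h
  refine h.trans ?_
  refine (mul_le_mul_left (rpow_lintegral_le_lipSeminorm hμ q a f Q) _).trans (le_of_eq ?_)
  rw [mul_assoc, ← ENNReal.rpow_add _ _ (hμ Q).1.ne' (hμ Q).2.ne]
  congr 2
  ring

/-- All the spaces `Λ_q(a)` with the same `a` coincide. -/
theorem exists_lipSeminorm_le_mul_lipSeminorm_one (hμ : D.IsNondegenerate μ) {p : ℝ} (hp : 0 < p)
    {a : ℝ} (ha : 0 ≤ a) :
    ∃ K : ℝ≥0, ∀ f : (Fin n → ℝ) → ℝ, (∀ Q, IntegrableOn f (D.cube Q) μ) →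
      D.lipSeminorm μ p a f ≤ K * D.lipSeminorm μ 1 a f := by
  set M : ℝ≥0∞ := ∑' j : ℕ, ((j : ℝ≥0∞) + 1) ^ p * 2⁻¹ ^ j with hM
  have hMtop : M < ∞ := ENNReal.tsum_rpow_mul_geometric_lt_top p
  have hM0 : M ≠ 0 := by
    intro h0
    have := ENNReal.tsum_eq_zero.1 h0 0
    simp at this
  set K : ℝ≥0∞ := M ^ (1 / p) * 2 with hK
  have hKtop : K ≠ ∞ :=
    ENNReal.mul_ne_top (ENNReal.rpow_ne_top_of_ne_zero hM0 hMtop.ne) ENNReal.ofNat_ne_top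
  have hK0 : K ≠ 0 :=
    mul_ne_zero (ENNReal.rpow_pos (pos_iff_ne_zero.2 hM0) hMtop.ne).ne' two_ne_zero
  refine ⟨K.toNNReal, fun f hf => ?_⟩
  rw [ENNReal.coe_toNNReal hKtop]
  have key : ∀ L : ℝ≥0∞, L ≠ 0 → L ≠ ∞ → D.lipSeminorm μ 1 a f ≤ L →
      D.lipSeminorm μ p a f ≤ K * L := by
    intro L hL0 hL1 hL
    rw [lipSeminorm_le_iff hμ]
    intro P
    have hm0 := (hμ P).1.ne'
    have hm1 := (hμ P).2.ne
    -- The constant $A=L\mu(P)^a$ serves all $R\subseteq P$ because `a` is nonnegative.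
    have h := lintegral_sub_mean_parent_rpow_le hμ hf (P := P) (A := L * μ (D.cube P) ^ a)
      (mul_ne_zero hL0 (ENNReal.rpow_pos (hμ P).1 hm1).ne')
      (ENNReal.mul_ne_top hL1 (ENNReal.rpow_ne_top_of_ne_zero hm0 hm1))
      (fun R hR => (lintegral_le_lipSeminorm_one hμ a f R).trans (by gcongr)) hp
    refine (ENNReal.rpow_le_rpow h (by positivity : 0 ≤ 1 / p)).trans (le_of_eq ?_)
    rw [ENNReal.mul_rpow_of_nonneg _ _ (by positivity),
      ENNReal.mul_rpow_of_nonneg _ _ (by positivity),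
      ← ENNReal.rpow_mul, mul_one_div_cancel hp.ne', ENNReal.rpow_one, hK,
      ENNReal.rpow_add _ _ hm0 hm1]
    ring
  rcases eq_or_ne (D.lipSeminorm μ 1 a f) ∞ with h1 | h1
  · rw [h1, ENNReal.mul_top hK0]
    exact le_top
  rcases eq_or_ne (D.lipSeminorm μ 1 a f) 0 with h0 | h0
  -- John–Nirenberg needs $A\ne0$, so a vanishing seminorm is replaced by $\varepsilon$, which then
  -- tends to zero.
  · rw [h0]
    have ht : Tendsto (fun ε : ℝ≥0∞ => K * ε) (𝓝[>] 0) (𝓝 (K * 0)) :=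
      (ENNReal.Tendsto.const_mul tendsto_id (Or.inr hKtop)).mono_left nhdsWithin_le_nhds
    refine ge_of_tendsto ht ?_
    filter_upwards [Ioo_mem_nhdsGT (zero_lt_one : (0 : ℝ≥0∞) < 1)] with ε hε
    exact key ε hε.1.ne' (hε.2.trans ENNReal.one_lt_top).ne (h0 ▸ zero_le)
  · exact key _ h0 h1 le_rfl

theorem MemLqLoc.integrableOn (hμ : D.IsNondegenerate μ) {q : ℝ} (hq : 1 ≤ q)
    {f : (Fin n → ℝ) → ℝ} (hf : D.MemLqLoc μ q f) (Q : CubeIndex n) :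
    IntegrableOn f (D.cube Q) μ := by
  have := isFiniteMeasure_restrict_cube hμ Q
  exact (hf Q).integrable (by simpa using ENNReal.ofReal_le_ofReal hq)

end DyadicSystem

/-! ### Haar functions and the scale of a balanced measure -/

namespace HaarSystem

variable {n : ℕ} {D : DyadicSystem n} {μ : Measure (Fin n → ℝ)} (H : HaarSystem D μ)

theorem h_eq_of_mem_child {Q R : CubeIndex n} (hR : R ∈ D.descendants 1 Q) (i : Fin (2 ^ n - 1))
    {x : Fin n → ℝ} (hx : x ∈ D.cube R) : H.h Q i x = H.h Q i (D.corner R) := by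
  obtain ⟨c, hc⟩ := H.const_on_children Q i R hR
  rw [hc x hx, hc _ (D.corner_mem_cube R)]

theorem h_eq_of_mem_cube {S P : CubeIndex n} (hg : S.1 < P.1) (i : Fin (2 ^ n - 1))
    {x : Fin n → ℝ} (hx : x ∈ D.cube P) : H.h S i x = H.h S i (D.corner P) := by
  by_cases hxS : x ∈ D.cube S
  · set R := D.cubeAt (S.1 + (1 : ℕ)) x
    have hR : R ∈ D.descendants 1 S := D.cubeAt_mem_descendants 1 hxS
    have hxR : x ∈ D.cube R := D.mem_cube_cubeAt _ _
    have hPR : D.cube P ⊆ D.cube R :=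
      D.cube_subset_of_mem (by rw [(D.mem_descendants.1 hR).1]; push_cast; omega) hxR hx
    rw [H.h_eq_of_mem_child hR i hxR, H.h_eq_of_mem_child hR i (hPR (D.corner_mem_cube P))]
  · have hcS : D.corner P ∉ D.cube S := fun hc =>
      hxS (D.cube_subset_of_mem hg.le hc (D.corner_mem_cube P) hx)
    rw [H.support S i x hxS, H.support S i _ hcS]

theorem h_eq_sum_indicator (Q : CubeIndex n) (i : Fin (2 ^ n - 1)) :
    H.h Q i = fun x => ∑ R ∈ D.descendants 1 Q,
      (D.cube R).indicator (fun _ => H.h Q i (D.corner R)) x := by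
  funext x
  by_cases hx : x ∈ D.cube Q
  · have hR := D.cubeAt_mem_descendants 1 hx
    have hxR : x ∈ D.cube (D.cubeAt (Q.1 + (1 : ℕ)) x) := D.mem_cube_cubeAt _ _
    rw [Finset.sum_eq_single _ _ fun h => absurd hR h, Set.indicator_of_mem hxR,
      H.h_eq_of_mem_child hR i hxR]
    intro S hS hne
    refine Set.indicator_of_notMem (fun hxS => hne ?_) _
    exact D.eq_of_mem_cube (D.mem_descendants.1 hS).1 hxS hxR
  · rw [H.support Q i x hx]
    refine (Finset.sum_eq_zero fun S hS => Set.indicator_of_notMem (fun hxS => hx ?_) _).symm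
    exact (D.mem_descendants.1 hS).2 hxS

theorem measurable_h (Q : CubeIndex n) (i : Fin (2 ^ n - 1)) : Measurable (H.h Q i) := by
  rw [H.h_eq_sum_indicator Q i]
  exact Finset.measurable_sum _ fun R _ => measurable_const.indicator (D.measurableSet_cube R)

theorem memLp_h (hμ : D.IsNondegenerate μ) (p : ℝ≥0∞) (Q : CubeIndex n) (i : Fin (2 ^ n - 1)) :
    MemLp (H.h Q i) p μ := by
  rw [H.h_eq_sum_indicator Q i]
  exact memLp_finsetSum _ fun R _ =>
    memLp_indicator_const p (D.measurableSet_cube R) _ (Or.inr (hμ R).2.ne)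

theorem integrable_h (hμ : D.IsNondegenerate μ) (Q : CubeIndex n) (i : Fin (2 ^ n - 1)) :
    Integrable (H.h Q i) μ :=
  memLp_one_iff_integrable.1 (H.memLp_h hμ 1 Q i)

theorem exists_bound_h (Q : CubeIndex n) (i : Fin (2 ^ n - 1)) :
    ∃ B : ℝ, ∀ x, ‖H.h Q i x‖ ≤ B := by
  refine ⟨∑ R ∈ D.descendants 1 Q, ‖H.h Q i (D.corner R)‖, fun x => ?_⟩
  by_cases hx : x ∈ D.cube Q
  · have hR := D.cubeAt_mem_descendants 1 hx
    rw [H.h_eq_of_mem_child hR i (D.mem_cube_cubeAt _ _)]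
    exact Finset.single_le_sum (f := fun R => ‖H.h Q i (D.corner R)‖)
      (fun _ _ => norm_nonneg _) hR
  · rw [H.support Q i x hx, norm_zero]
    exact Finset.sum_nonneg fun _ _ => norm_nonneg _

theorem integrableOn_mul_h {f : (Fin n → ℝ) → ℝ} {Q S : CubeIndex n}
    (hf : IntegrableOn f (D.cube Q) μ) (i : Fin (2 ^ n - 1)) :
    IntegrableOn (fun x => f x * H.h S i x) (D.cube Q) μ := by
  obtain ⟨B, hB⟩ := H.exists_bound_h S i
  exact Integrable.mul_bdd (c := B) hf (H.measurable_h S i).aestronglyMeasurable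
    (Eventually.of_forall hB)

theorem integral_mul_h_eq_setIntegral (f : (Fin n → ℝ) → ℝ) {P Q : CubeIndex n}
    (hQ : D.cube Q ⊆ D.cube P) (i : Fin (2 ^ n - 1)) :
    ∫ x, f x * H.h Q i x ∂μ = ∫ x in D.cube P, f x * H.h Q i x ∂μ :=
  (setIntegral_eq_integral_of_forall_compl_eq_zero fun x hx => by
    rw [H.support Q i x fun h => hx (hQ h), mul_zero]).symm

theorem integral_mul_h_eq_sum {f : (Fin n → ℝ) → ℝ} {Q : CubeIndex n}
    (hf : IntegrableOn f (D.cube Q) μ) (i : Fin (2 ^ n - 1)) :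
    ∫ x, f x * H.h Q i x ∂μ
      = ∑ R ∈ D.descendants 1 Q, H.h Q i (D.corner R) * ∫ x in D.cube R, f x ∂μ := by
  rw [H.integral_mul_h_eq_setIntegral f subset_rfl,
    D.integral_cube_eq_sum μ 1 Q (H.integrableOn_mul_h hf i)]
  refine Finset.sum_congr rfl fun R hR => ?_
  rw [mul_comm, ← integral_mul_const]
  exact setIntegral_congr_fun (D.measurableSet_cube R) fun x hx => by
    simp only [H.h_eq_of_mem_child hR i hx]

theorem setIntegral_h_eq_zero {P S : CubeIndex n} (hg : P.1 ≤ S.1) (i : Fin (2 ^ n - 1)) :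
    ∫ x in D.cube P, H.h S i x ∂μ = 0 := by
  rcases D.disjoint_or_subset hg with h | h
  · refine setIntegral_eq_zero_of_forall_eq_zero fun x hx => H.support S i x ?_
    exact Set.disjoint_left.1 h hx
  · rw [setIntegral_eq_integral_of_forall_compl_eq_zero, H.integral_eq_zero]
    exact fun x hx => H.support S i x fun hxS => hx (h hxS)

theorem sum_h_mul_measureReal (hμ : D.IsNondegenerate μ) (Q : CubeIndex n)
    (i : Fin (2 ^ n - 1)) :
    ∑ R ∈ D.descendants 1 Q, H.h Q i (D.corner R) * μ.real (D.cube R) = 0 := by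
  have h := H.integral_mul_h_eq_sum (DyadicSystem.integrableOn_const_cube hμ Q 1) i
  simp only [one_mul, H.integral_eq_zero, setIntegral_const, smul_eq_mul, mul_one] at h
  exact h.symm

theorem integral_h_mul_h_eq_sum (hμ : D.IsNondegenerate μ) (Q : CubeIndex n)
    (i j : Fin (2 ^ n - 1)) :
    ∫ x, H.h Q i x * H.h Q j x ∂μ = ∑ R ∈ D.descendants 1 Q,
      H.h Q i (D.corner R) * H.h Q j (D.corner R) * μ.real (D.cube R) := by
  rw [H.integral_mul_h_eq_sum (H.integrable_h hμ Q i).integrableOn j]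
  refine Finset.sum_congr rfl fun R hR => ?_
  rw [setIntegral_congr_fun (g := fun _ => H.h Q i (D.corner R)) (D.measurableSet_cube R)
    fun x hx => H.h_eq_of_mem_child hR i hx, setIntegral_const, smul_eq_mul]
  ring

/-- The Haar functions attached to `Q` together with the normalised indicator of `Q` are an
orthonormal basis of the functions on `Q` that are constant on the children of `Q`. -/
theorem sum_sq_mul_measureReal_add (hμ : D.IsNondegenerate μ) {Q R : CubeIndex n}
    (hR : R ∈ D.descendants 1 Q) :
    (∑ i, H.h Q i (D.corner R) ^ 2) * μ.real (D.cube R)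
      + μ.real (D.cube R) / μ.real (D.cube Q) = 1 := by
  classical
  -- The index `none` stands for the normalised indicator of `Q`. Weighting columns by
  -- $\sqrt{\mu(S)}$ turns orthonormality in $L^2(\mu)$ into orthonormality of the rows of `A`.
  let v : Option (Fin (2 ^ n - 1)) → CubeIndex n → ℝ := fun o S =>
    o.elim (√(μ.real (D.cube Q)))⁻¹ fun i => H.h Q i (D.corner S)
  let A : Matrix (Option (Fin (2 ^ n - 1))) (D.descendants 1 Q) ℝ :=
    Matrix.of fun o S => v o S * √(μ.real (D.cube S))
  have hQ := DyadicSystem.measureReal_cube_pos hμ Q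
  have hA : A * A.transpose = 1 := by
    ext o o'
    have e : (A * A.transpose) o o'
        = ∑ S ∈ D.descendants 1 Q, v o S * v o' S * μ.real (D.cube S) := by
      rw [Matrix.mul_apply,
        ← Finset.sum_coe_sort _ fun S => v o S * v o' S * μ.real (D.cube S)]
      refine Finset.sum_congr rfl fun S _ => ?_
      have := Real.mul_self_sqrt (measureReal_nonneg (μ := μ) (s := D.cube S))
      simp only [A, Matrix.transpose_apply, Matrix.of_apply]
      linear_combination v o S * v o' S * this
    rw [e]
    rcases o with _ | i <;> rcases o' with _ | j
    · have hs : μ.real (D.cube Q) = ∑ S ∈ D.descendants 1 Q, μ.real (D.cube S) := by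
        have := D.integral_cube_eq_sum μ 1 Q (DyadicSystem.integrableOn_const_cube hμ Q 1)
        simpa using this
      simp only [v, Option.elim, Matrix.one_apply_eq]
      rw [← Finset.mul_sum, ← hs, ← mul_inv, Real.mul_self_sqrt hQ.le, inv_mul_cancel₀ hQ.ne']
    · simp only [v, Option.elim, mul_assoc]
      rw [← Finset.mul_sum, H.sum_h_mul_measureReal hμ, mul_zero]
      simp
    · simp only [v, Option.elim]
      have e2 : ∀ S ∈ D.descendants 1 Q,
          H.h Q i (D.corner S) * (√(μ.real (D.cube Q)))⁻¹ * μ.real (D.cube S)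
          = (√(μ.real (D.cube Q)))⁻¹ * (H.h Q i (D.corner S) * μ.real (D.cube S)) :=
        fun S _ => by ring
      rw [Finset.sum_congr rfl e2, ← Finset.mul_sum, H.sum_h_mul_measureReal hμ, mul_zero]
      simp
    · simp only [v, Option.elim]
      rw [← H.integral_h_mul_h_eq_sum hμ]
      by_cases hij : i = j
      · subst hij
        rw [H.normalized, Matrix.one_apply_eq]
      · rw [H.orthogonal Q i Q j (by simpa using hij), Matrix.one_apply_ne (by simpa using hij)]
  have hcard : Fintype.card (Option (Fin (2 ^ n - 1))) = Fintype.card (D.descendants 1 Q) := by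
    rw [Fintype.card_option, Fintype.card_fin, Fintype.card_coe, D.card_descendants, mul_one]
    exact Nat.sub_add_cancel Nat.one_le_two_pow
  -- The matrix is square, so its columns are orthonormal as well; the claim is the squared norm of
  -- the column of `R`.
  have hA' : A.transpose * A = 1 := (Matrix.mul_eq_one_comm_of_card_eq _ _ _ hcard).1 hA
  have h := congrFun (congrFun hA' ⟨R, hR⟩) ⟨R, hR⟩
  rw [Matrix.mul_apply, Matrix.one_apply_eq, Fintype.sum_option] at h
  simp only [A, v, Matrix.transpose_apply, Matrix.of_apply, Option.elim] at h
  have hs := Real.mul_self_sqrt (measureReal_nonneg (μ := μ) (s := D.cube R))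
  have hsQ := Real.mul_self_sqrt hQ.le
  have e1 : ∀ i, H.h Q i (D.corner R) * √(μ.real (D.cube R)) *
      (H.h Q i (D.corner R) * √(μ.real (D.cube R)))
      = H.h Q i (D.corner R) ^ 2 * μ.real (D.cube R) := fun i => by
    linear_combination H.h Q i (D.corner R) ^ 2 * hs
  have e2 : (√(μ.real (D.cube Q)))⁻¹ * √(μ.real (D.cube R)) *
      ((√(μ.real (D.cube Q)))⁻¹ * √(μ.real (D.cube R)))
      = μ.real (D.cube R) / μ.real (D.cube Q) := by
    calc _ = (√(μ.real (D.cube R)) * √(μ.real (D.cube R))) /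
          (√(μ.real (D.cube Q)) * √(μ.real (D.cube Q))) := by
          rw [div_eq_mul_inv, mul_inv]; ring
      _ = _ := by rw [hs, hsQ]
  rw [Finset.sum_congr rfl fun i _ => e1 i, ← Finset.sum_mul, e2] at h
  linarith

/-- A child has positive measure, so an almost-everywhere bound holds at some point of it, hence on
all of it. -/
theorem abs_h_le_eLpNorm_top (hμ : D.IsNondegenerate μ) {Q R : CubeIndex n}
    (hR : R ∈ D.descendants 1 Q) (i : Fin (2 ^ n - 1)) :
    |H.h Q i (D.corner R)| ≤ (eLpNorm (H.h Q i) ∞ μ).toReal := by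
  have h1 : ∀ᵐ x ∂μ, ‖H.h Q i x‖ₑ ≤ eLpNorm (H.h Q i) ∞ μ := by
    rw [eLpNorm_exponent_top]
    exact enorm_ae_le_eLpNormEssSup _ _
  have h2 : ∃ x ∈ D.cube R, ‖H.h Q i x‖ₑ ≤ eLpNorm (H.h Q i) ∞ μ := by
    by_contra! hc
    refine (hμ R).1.ne' (measure_mono_null (fun x hx => ?_) (ae_iff.1 h1))
    exact not_le.2 (hc x hx)
  obtain ⟨x, hx, hle⟩ := h2
  rw [H.h_eq_of_mem_child hR i hx] at hle
  have := ENNReal.toReal_mono (H.memLp_h hμ ∞ Q i).2.ne hle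
  simpa using this

theorem toReal_eLpNorm_one_h (hμ : D.IsNondegenerate μ) (Q : CubeIndex n)
    (i : Fin (2 ^ n - 1)) :
    (eLpNorm (H.h Q i) 1 μ).toReal
      = ∑ R ∈ D.descendants 1 Q, |H.h Q i (D.corner R)| * μ.real (D.cube R) := by
  have h_int := (H.integrable_h hμ Q i).norm
  rw [eLpNorm_one_eq_lintegral_enorm, ← integral_norm_eq_lintegral_enorm
      (H.measurable_h Q i).aestronglyMeasurable,
    ← setIntegral_eq_integral_of_forall_compl_eq_zero (s := D.cube Q)
      (fun x hx => by rw [H.support Q i x hx, norm_zero]),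
    D.integral_cube_eq_sum μ 1 Q h_int.integrableOn]
  refine Finset.sum_congr rfl fun R hR => ?_
  rw [setIntegral_congr_fun (g := fun _ => |H.h Q i (D.corner R)|) (D.measurableSet_cube R)
    fun x hx => by simp only [Real.norm_eq_abs, H.h_eq_of_mem_child hR i hx],
    setIntegral_const, smul_eq_mul, mul_comm]

/-- For a balanced measure the Haar functions attached to `Q` are governed by one positive number
`b Q`, comparable to all their `L¹`-norms and, up to inversion, to all their `L^∞`-norms. -/
theorem exists_scale (hn : 1 ≤ n) (hμ : D.IsNondegenerate μ) (hbal : H.Balanced) :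
    ∃ (b : CubeIndex n → ℝ) (K : ℝ), 1 ≤ K ∧ (∀ Q, 0 < b Q) ∧
      (∀ Q, ∀ R ∈ D.descendants 1 Q, b Q ≤ K * b R ∧ b R ≤ K * b Q) ∧
      (∀ Q i, ∀ R ∈ D.descendants 1 Q,
        |H.h Q i (D.corner R)| * μ.real (D.cube R) ≤ K * b Q ∧
        |H.h Q i (D.corner R)| * b Q ≤ K) ∧
      ∀ Q, b Q ^ 2 ≤ K * μ.real (D.cube Q) := by
  set u : CubeIndex n → Fin (2 ^ n - 1) → ℝ := fun Q i => (eLpNorm (H.h Q i) 1 μ).toReal with hu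
  set w : CubeIndex n → Fin (2 ^ n - 1) → ℝ := fun Q i => (eLpNorm (H.h Q i) ∞ μ).toReal with hw
  have hu0 : ∀ Q i, 0 ≤ u Q i := fun Q i => ENNReal.toReal_nonneg
  have hw0 : ∀ Q i, 0 ≤ w Q i := fun Q i => ENNReal.toReal_nonneg
  obtain ⟨K, hK1, hK⟩ : ∃ K : ℝ, 1 ≤ K ∧ ∀ Q, ∀ R ∈ D.descendants 1 Q, ∀ i j,
      u Q i * w R j ≤ K ∧ w Q i * u R j ≤ K := by
    set B : ℝ≥0∞ := ⨆ (Q : CubeIndex n) (R ∈ D.descendants 1 Q) (i : Fin (2 ^ n - 1))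
      (j : Fin (2 ^ n - 1)), (eLpNorm (H.h Q i) 1 μ * eLpNorm (H.h R j) ∞ μ +
        eLpNorm (H.h Q i) ∞ μ * eLpNorm (H.h R j) 1 μ) with hB
    have hBtop : B ≠ ∞ := ne_of_lt hbal
    refine ⟨max 1 B.toReal, le_max_left _ _, fun Q R hR i j => ?_⟩
    have hle : eLpNorm (H.h Q i) 1 μ * eLpNorm (H.h R j) ∞ μ +
        eLpNorm (H.h Q i) ∞ μ * eLpNorm (H.h R j) 1 μ ≤ B :=
      le_iSup_of_le Q (le_iSup_of_le R (le_iSup_of_le hR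
        (le_iSup_of_le i (le_iSup_of_le j le_rfl))))
    refine ⟨le_trans ?_ (le_max_right _ _), le_trans ?_ (le_max_right _ _)⟩
    · rw [hu, hw, ← ENNReal.toReal_mul]
      exact ENNReal.toReal_mono hBtop (le_self_add.trans hle)
    · rw [hu, hw, ← ENNReal.toReal_mul]
      exact ENNReal.toReal_mono hBtop (le_add_self.trans hle)
  -- From $1=\|h\|_2^2\le\|h\|_1\|h\|_\infty$.
  have hone : ∀ Q i, 1 ≤ u Q i * w Q i := by
    intro Q i
    rw [← H.normalized Q i, H.integral_h_mul_h_eq_sum hμ, hu]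
    simp only
    rw [H.toReal_eLpNorm_one_h hμ, Finset.sum_mul]
    refine Finset.sum_le_sum fun R hR => ?_
    rw [← abs_mul_abs_self]
    have := H.abs_h_le_eLpNorm_top hμ hR i
    nlinarith [mul_nonneg (abs_nonneg (H.h Q i (D.corner R)))
      (measureReal_nonneg (μ := μ) (s := D.cube R))]
  have hupos : ∀ Q i, 0 < u Q i := fun Q i => by
    rcases (hu0 Q i).eq_or_lt with h | h
    · have := hone Q i
      rw [← h, zero_mul] at this
      linarith
    · exact h
  have hK0 : 0 ≤ K := zero_le_one.trans hK1
  -- Multiply by $1\le\|h_R\|_1\|h_R\|_\infty$ and use balance on $\|h_Q\|_1\|h_R\|_\infty$;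
  -- symmetrically with the roles of `Q` and `R` exchanged.
  have huu : ∀ Q, ∀ R ∈ D.descendants 1 Q, ∀ i j, u Q i ≤ K * u R j ∧ u R j ≤ K * u Q i := by
    intro Q R hR i j
    constructor
    · nlinarith [hone R j, (hK Q R hR i j).1, hupos Q i, hupos R j,
        mul_le_mul_of_nonneg_left (hone R j) (hu0 Q i),
        mul_le_mul_of_nonneg_right (hK Q R hR i j).1 (hu0 R j)]
    · nlinarith [mul_le_mul_of_nonneg_left (hone Q i) (hu0 R j),
        mul_le_mul_of_nonneg_right (hK Q R hR i j).2 (hu0 Q i)]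
  have h2n : 0 < 2 ^ n - 1 := by
    have : 2 ^ 1 ≤ 2 ^ n := Nat.pow_le_pow_right two_pos hn
    omega
  -- The scale `b Q` is the $L^1$ norm of one fixed Haar function of `Q`; one exists because
  -- $n\ge1$.
  set o : Fin (2 ^ n - 1) := ⟨0, h2n⟩
  -- Balance relates only a cube to its children, so two Haar functions of the same cube are
  -- compared through a child, at the cost of $K^2$.
  have huo : ∀ Q i, u Q i ≤ K ^ 2 * u Q o := by
    intro Q i
    obtain ⟨R, hR⟩ := D.descendants_nonempty 1 Q
    have h1 := (huu Q R hR i o).1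
    have h2 := (huu Q R hR o o).2
    nlinarith
  have hwo : ∀ Q i, w Q i * u Q o ≤ K ^ 2 := by
    intro Q i
    obtain ⟨R, hR⟩ := D.descendants_nonempty 1 Q
    have h1 := (huu Q R hR o o).1
    have h2 := (hK Q R hR i o).2
    have h3 := mul_le_mul_of_nonneg_left h1 (hw0 Q i)
    nlinarith
  have hKK : K ≤ K ^ 4 := le_self_pow₀ hK1 (by norm_num)
  have hK24 : K ^ 2 ≤ K ^ 4 := pow_le_pow_right₀ hK1 (by norm_num)
  refine ⟨fun Q => u Q o, K ^ 4, one_le_pow₀ hK1, fun Q => hupos Q o, fun Q R hR => ⟨?_, ?_⟩,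
    fun Q i R hR => ⟨?_, ?_⟩, fun Q => ?_⟩
  · exact (huu Q R hR o o).1.trans (mul_le_mul_of_nonneg_right hKK (hu0 R o))
  · exact (huu Q R hR o o).2.trans (mul_le_mul_of_nonneg_right hKK (hu0 Q o))
  · refine le_trans ?_ ((huo Q i).trans (mul_le_mul_of_nonneg_right hK24 (hu0 Q o)))
    rw [hu]
    simp only
    rw [H.toReal_eLpNorm_one_h hμ]
    exact Finset.single_le_sum
      (f := fun R => |H.h Q i (D.corner R)| * μ.real (D.cube R))
      (fun S _ => mul_nonneg (abs_nonneg _) measureReal_nonneg) hR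
  · exact (mul_le_mul_of_nonneg_right (H.abs_h_le_eLpNorm_top hμ hR i) (hu0 Q o)).trans
      ((hwo Q i).trans hK24)
  -- Here $1=\|h\|_2^2\le\|h\|_\infty^2\,\mu(Q)$, while $\|h\|_\infty\, b(Q)\le K^2$.
  · have h1 : (1 : ℝ) ≤ w Q o ^ 2 * μ.real (D.cube Q) := by
      have hs : μ.real (D.cube Q) = ∑ S ∈ D.descendants 1 Q, μ.real (D.cube S) := by
        have := D.integral_cube_eq_sum μ 1 Q (DyadicSystem.integrableOn_const_cube hμ Q 1)
        simpa using this
      rw [← H.normalized Q o, H.integral_h_mul_h_eq_sum hμ, hs, Finset.mul_sum]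
      refine Finset.sum_le_sum fun R hR => mul_le_mul_of_nonneg_right ?_ measureReal_nonneg
      rw [← abs_mul_abs_self, ← pow_two]
      exact pow_le_pow_left₀ (abs_nonneg _) (H.abs_h_le_eLpNorm_top hμ hR o) 2
    calc u Q o ^ 2 = u Q o ^ 2 * 1 := (mul_one _).symm
      _ ≤ u Q o ^ 2 * (w Q o ^ 2 * μ.real (D.cube Q)) := by gcongr
      _ = (w Q o * u Q o) ^ 2 * μ.real (D.cube Q) := by ring
      _ ≤ (K ^ 2) ^ 2 * μ.real (D.cube Q) := by
          gcongr
          exact hwo Q o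
      _ = _ := by ring

end HaarSystem

/-! ### Haar coefficients of Lipschitz functions -/

namespace DyadicSystem

variable {n : ℕ} {D : DyadicSystem n} {μ : Measure (Fin n → ℝ)}

theorem mem_descendants_of_le {Q R : CubeIndex n} {x : Fin n → ℝ} {r : ℕ} (hg : R.1 = Q.1 + r)
    (hQ : x ∈ D.cube Q) (hR : x ∈ D.cube R) : R ∈ D.descendants r Q :=
  D.mem_descendants.2 ⟨hg, D.cube_subset_of_mem (by omega) hQ hR⟩

theorem exists_mem_descendants_of_succ {r : ℕ} {Q R : CubeIndex n}
    (hR : R ∈ D.descendants (r + 1) Q) :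
    ∃ S ∈ D.descendants r Q, R ∈ D.descendants 1 S := by
  obtain ⟨h1, h2⟩ := D.mem_descendants.1 hR
  refine ⟨D.parent R, mem_descendants_of_le (x := D.corner R) ?_ (h2 (D.corner_mem_cube R))
    (D.cube_subset_cube_parent R (D.corner_mem_cube R)), D.mem_descendants_parent R⟩
  simp only [parent, cubeAt, h1]
  push_cast
  ring

theorem measureReal_cube_eq_sum (hμ : D.IsNondegenerate μ) (r : ℕ) (Q : CubeIndex n) :
    μ.real (D.cube Q) = ∑ S ∈ D.descendants r Q, μ.real (D.cube S) := by
  have := D.integral_cube_eq_sum μ r Q (integrableOn_const_cube hμ Q 1)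
  simpa using this

theorem abs_mean_sub_mean_parent_le (hμ : D.IsNondegenerate μ) {a : ℝ} {f : (Fin n → ℝ) → ℝ}
    (hf : ∀ Q, IntegrableOn f (D.cube Q) μ) (hL : D.lipSeminorm μ 1 a f ≠ ∞) (Q : CubeIndex n) :
    |D.mean μ f Q - D.mean μ f (D.parent Q)|
      ≤ (D.lipSeminorm μ 1 a f).toReal * μ.real (D.cube Q) ^ a := by
  have h0 := (hμ Q).1.ne'
  have h1 := (hμ Q).2.ne
  have h := (enorm_mean_sub_mul_le hμ (hf Q) (D.mean μ f (D.parent Q))).trans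
    (lintegral_le_lipSeminorm_one hμ a f Q)
  have h' := (ENNReal.mul_le_mul_iff_left h0 h1).1 h
  have := ENNReal.toReal_mono
    (ENNReal.mul_ne_top hL (ENNReal.rpow_ne_top_of_ne_zero h0 h1)) h'
  rwa [toReal_enorm, Real.norm_eq_abs, ENNReal.toReal_mul, ← ENNReal.toReal_rpow] at this

end DyadicSystem

namespace HaarSystem

open DyadicSystem

variable {n : ℕ} {D : DyadicSystem n} {μ : Measure (Fin n → ℝ)} (H : HaarSystem D μ)

/-- A child of mass at most $\mu(Q)/2$ has mass $\lesssim b(Q)^2$, and at most one child may fail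
this. The relation $\sum_R\mu(R)(\langle f\rangle_R-\langle f\rangle_Q)=0$ removes that child from
the coefficient. Each remaining summand is at most a multiple of $b(Q)$ times $L\,b(Q)^{2a}$. The
bound is in terms of `b Q` rather than $\mu(Q)$ because only `b` is comparable along the tree. -/
theorem abs_integral_mul_h_le (hμ : D.IsNondegenerate μ) {b : CubeIndex n → ℝ} {K : ℝ}
    (hK : 1 ≤ K) (hb : ∀ Q, 0 < b Q)
    (hbK : ∀ Q i, ∀ R ∈ D.descendants 1 Q,
        |H.h Q i (D.corner R)| * μ.real (D.cube R) ≤ K * b Q ∧ |H.h Q i (D.corner R)| * b Q ≤ K)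
    {a : ℝ} (ha : 0 < a) :
    ∃ C : ℝ, 0 ≤ C ∧ ∀ f : (Fin n → ℝ) → ℝ, (∀ Q, IntegrableOn f (D.cube Q) μ) →
      D.lipSeminorm μ 1 a f ≠ ∞ → ∀ Q i,
        |∫ x, f x * H.h Q i x ∂μ|
          ≤ C * (D.lipSeminorm μ 1 a f).toReal * (b Q ^ 2) ^ (1 / 2 + a) := by
  classical
  set E : ℝ := 2 * (2 ^ n - 1 : ℕ) * K ^ 2 with hE
  have hE0 : 0 ≤ E := by positivity
  refine ⟨2 ^ n * (K * (1 + E) * E ^ a), by positivity, fun f hf hL Q i => ?_⟩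
  set L := (D.lipSeminorm μ 1 a f).toReal with hLdef
  have hL0 : 0 ≤ L := ENNReal.toReal_nonneg
  set v : CubeIndex n → ℝ := fun R => H.h Q i (D.corner R) with hv
  set m : CubeIndex n → ℝ := fun R => μ.real (D.cube R) with hm
  set y : CubeIndex n → ℝ := fun R => D.mean μ f R - D.mean μ f Q with hy
  have hmpos : ∀ R, 0 < m R := measureReal_cube_pos hμ
  have hy_le : ∀ R ∈ D.descendants 1 Q, |y R| ≤ L * m R ^ a := by
    intro R hR
    have := abs_mean_sub_mean_parent_le hμ hf hL R
    rwa [D.parent_of_mem_descendants hR] at this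
  -- The heaviest child `Z` is the only one whose mass may be much larger than $b(Q)^2$.
  obtain ⟨Z, hZ, hmax⟩ := Finset.exists_max_image (D.descendants 1 Q) m (D.descendants_nonempty 1 Q)
  have hmQ : m Q = ∑ S ∈ D.descendants 1 Q, m S := measureReal_cube_eq_sum hμ 1 Q
  -- A child other than `Z` has at most half of $\mu(Q)$, so the basis identity gives
  -- $\tfrac12\le\sum_j h_j(R)^2\mu(R)$. Multiplying by $\mu(R)$ and using $|h_j(R)|\mu(R)\le K
  -- b(Q)$ yields the constant `E`.
  have hsmall : ∀ R ∈ (D.descendants 1 Q).erase Z, m R ≤ E * b Q ^ 2 := by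
    intro R hR
    obtain ⟨hne, hR⟩ := Finset.mem_erase.1 hR
    have h1 : m R + m Z ≤ m Q := by
      rw [hmQ, ← Finset.sum_pair hne]
      refine Finset.sum_le_sum_of_subset_of_nonneg ?_ fun S _ _ => (hmpos S).le
      intro S hS
      rcases Finset.mem_insert.1 hS with rfl | hS
      · exact hR
      · rwa [Finset.mem_singleton.1 hS]
    have h2 : m R / m Q ≤ 1 / 2 := by
      rw [div_le_iff₀ (hmpos Q)]
      linarith [hmax R hR]
    have h3 := H.sum_sq_mul_measureReal_add hμ hR
    change _ * m R + m R / m Q = 1 at h3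
    have h4 : (∑ j, H.h Q j (D.corner R) ^ 2) * m R ^ 2
        ≤ ((2 ^ n - 1 : ℕ) : ℝ) * (K * b Q) ^ 2 := by
      rw [Finset.sum_mul]
      refine (Finset.sum_le_card_nsmul _ _ ((K * b Q) ^ 2) fun j _ => ?_).trans
        (by simp [nsmul_eq_mul])
      have h5 := (hbK Q j R hR).1
      rw [← sq_abs, ← mul_pow]
      exact pow_le_pow_left₀ (mul_nonneg (abs_nonneg _) (hmpos R).le) h5 2
    have h6 : m R * (1 / 2) ≤ (∑ j, H.h Q j (D.corner R) ^ 2) * m R ^ 2 := by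
      have : 1 / 2 ≤ (∑ j, H.h Q j (D.corner R) ^ 2) * m R := by linarith
      calc m R * (1 / 2) ≤ m R * ((∑ j, H.h Q j (D.corner R) ^ 2) * m R) :=
            mul_le_mul_of_nonneg_left this (hmpos R).le
        _ = _ := by ring
    rw [hE]
    linarith
  have hEb : 0 ≤ E * b Q ^ 2 := by positivity
  have hyE : ∀ R ∈ (D.descendants 1 Q).erase Z, |y R| ≤ L * (E * b Q ^ 2) ^ a := by
    intro R hR
    refine (hy_le R (Finset.mem_of_mem_erase hR)).trans (mul_le_mul_of_nonneg_left ?_ hL0)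
    exact Real.rpow_le_rpow (hmpos R).le (hsmall R hR) ha.le
  have hsum0 : ∑ R ∈ D.descendants 1 Q, m R * y R = 0 := by
    have e : ∀ R ∈ D.descendants 1 Q,
        m R * y R = (∫ x in D.cube R, f x ∂μ) - m R * D.mean μ f Q := by
      intro R _
      rw [← mean_mul hμ]
      simp only [hy, hm]
      ring
    rw [Finset.sum_congr rfl e, Finset.sum_sub_distrib, ← D.integral_cube_eq_sum μ 1 Q (hf Q),
      ← Finset.sum_mul, ← hmQ, ← mean_mul hμ]
    simp only [hm]
    ring
  have hcoef : ∫ x, f x * H.h Q i x ∂μ = ∑ R ∈ D.descendants 1 Q, v R * (m R * y R) := by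
    have e : ∀ R ∈ D.descendants 1 Q, v R * (m R * y R)
        = H.h Q i (D.corner R) * (∫ x in D.cube R, f x ∂μ)
          - H.h Q i (D.corner R) * μ.real (D.cube R) * D.mean μ f Q := by
      intro R _
      rw [← mean_mul hμ]
      simp only [hy, hm, hv]
      ring
    rw [Finset.sum_congr rfl e, Finset.sum_sub_distrib, ← Finset.sum_mul,
      H.sum_h_mul_measureReal hμ, zero_mul, sub_zero, H.integral_mul_h_eq_sum (hf Q)]
  -- The summand of `Z` is rewritten through `hsum0` in terms of the other children.
  have hcoef' : ∫ x, f x * H.h Q i x ∂μ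
      = ∑ R ∈ (D.descendants 1 Q).erase Z, (v R * m R - v Z * m R) * y R := by
    rw [← Finset.add_sum_erase _ _ hZ] at hsum0 hcoef
    rw [hcoef, eq_neg_of_add_eq_zero_left hsum0, mul_neg, Finset.mul_sum, neg_add_eq_sub,
      ← Finset.sum_sub_distrib]
    exact Finset.sum_congr rfl fun R _ => by ring
  have hterm : ∀ R ∈ (D.descendants 1 Q).erase Z,
      |(v R * m R - v Z * m R) * y R| ≤ (K * (1 + E) * b Q) * (L * (E * b Q ^ 2) ^ a) := by
    intro R hR
    rw [abs_mul]
    refine mul_le_mul ?_ (hyE R hR) (abs_nonneg _) (by have := hb Q; positivity)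
    have h1 := (hbK Q i R (Finset.mem_of_mem_erase hR)).1
    have h2 := (hbK Q i Z hZ).2
    -- The value on `Z` now multiplies the mass of a light child, so $|v_Z|\,b\le K$ and $\mu(R)\le
    -- E b^2$ leave one power of $b$.
    have h3 : |v Z| * m R ≤ K * E * b Q := by
      calc |v Z| * m R ≤ |v Z| * (E * b Q ^ 2) :=
            mul_le_mul_of_nonneg_left (hsmall R hR) (abs_nonneg _)
        _ = (|v Z| * b Q) * (E * b Q) := by ring
        _ ≤ K * (E * b Q) := mul_le_mul_of_nonneg_right h2 (mul_nonneg hE0 (hb Q).le)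
        _ = _ := by ring
    calc |v R * m R - v Z * m R| ≤ |v R * m R| + |v Z * m R| := abs_sub _ _
      _ = |v R| * m R + |v Z| * m R := by rw [abs_mul, abs_mul, abs_of_pos (hmpos R)]
      _ ≤ K * b Q + K * E * b Q := add_le_add h1 h3
      _ = _ := by ring
  have hcard : (((D.descendants 1 Q).erase Z).card : ℝ) ≤ 2 ^ n := by
    have := (Finset.card_erase_le (s := D.descendants 1 Q) (a := Z)).trans_eq
      (D.card_descendants 1 Q)
    rw [mul_one] at this
    exact_mod_cast this
  have hpow : b Q * (E * b Q ^ 2) ^ a = E ^ a * (b Q ^ 2) ^ (1 / 2 + a) := by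
    rw [Real.mul_rpow hE0 (by positivity), Real.rpow_add (pow_pos (hb Q) 2), ← Real.sqrt_eq_rpow,
      Real.sqrt_sq (hb Q).le]
    ring
  rw [hcoef']
  calc |∑ R ∈ (D.descendants 1 Q).erase Z, (v R * m R - v Z * m R) * y R|
      ≤ ∑ R ∈ (D.descendants 1 Q).erase Z, |(v R * m R - v Z * m R) * y R| :=
        Finset.abs_sum_le_sum_abs _ _
    _ ≤ ((D.descendants 1 Q).erase Z).card • ((K * (1 + E) * b Q) * (L * (E * b Q ^ 2) ^ a)) :=
        Finset.sum_le_card_nsmul _ _ _ hterm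
    _ ≤ 2 ^ n * ((K * (1 + E) * b Q) * (L * (E * b Q ^ 2) ^ a)) := by
        rw [nsmul_eq_mul]
        refine mul_le_mul_of_nonneg_right hcard ?_
        have := hb Q
        positivity
    _ = 2 ^ n * (K * (1 + E)) * L * (b Q * (E * b Q ^ 2) ^ a) := by ring
    _ = _ := by rw [hpow]; ring

/-- Haar coefficients of a function in `Λ_1(a)` are controlled by the measure of *every* cube at
bounded distance in the dyadic tree. -/
theorem exists_abs_integral_mul_h_le (hn : 1 ≤ n) (hμ : D.IsNondegenerate μ) (hbal : H.Balanced)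
    {a : ℝ} (ha : 0 < a) (r M : ℕ) :
    ∃ C : ℝ, 0 ≤ C ∧ ∀ f : (Fin n → ℝ) → ℝ, (∀ Q, IntegrableOn f (D.cube Q) μ) →
      D.lipSeminorm μ 1 a f ≠ ∞ → ∀ Q, ∀ R ∈ D.descendants r Q, ∀ m ≤ M,
        ∀ P ∈ D.descendants m Q, ∀ i,
        |∫ x, f x * H.h R i x ∂μ|
          ≤ C * (D.lipSeminorm μ 1 a f).toReal * μ.real (D.cube P) ^ (1 / 2 + a) := by
  obtain ⟨b, K, hK, hb, hbb, hbK, hbm⟩ := H.exists_scale hn hμ hbal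
  obtain ⟨C, hC0, hC⟩ := H.abs_integral_mul_h_le hμ hK hb hbK ha
  have hK0 : 0 ≤ K := zero_le_one.trans hK
  have hdown : ∀ (m : ℕ) (Q : CubeIndex n), ∀ R ∈ D.descendants m Q,
      b R ≤ K ^ m * b Q ∧ b Q ≤ K ^ m * b R := by
    intro m
    induction m with
    | zero =>
      intro Q R hR
      have h := D.mem_descendants.1 hR
      have : R = Q := D.eq_of_mem_cube (by simpa using h.1) (D.corner_mem_cube R)
        (h.2 (D.corner_mem_cube R))
      simp [this]
    | succ m ih =>
      intro Q R hR
      obtain ⟨S, hS, hRS⟩ := exists_mem_descendants_of_succ hR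
      have h1 := ih Q S hS
      have h2 := hbb S R hRS
      constructor
      · calc b R ≤ K * b S := h2.2
          _ ≤ K * (K ^ m * b Q) := mul_le_mul_of_nonneg_left h1.1 hK0
          _ = _ := by ring
      · calc b Q ≤ K ^ m * b S := h1.2
          _ ≤ K ^ m * (K * b R) := mul_le_mul_of_nonneg_left h2.1 (by positivity)
          _ = _ := by ring
  -- Going up `r` generations from `R` to `Q` and down at most `M` to `P` costs $K^rK^M$ in `b`; the
  -- last factor comes from $b(P)^2\le K\mu(P)$.
  set E : ℝ := (K ^ r * K ^ M) ^ 2 * K with hE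
  refine ⟨C * E ^ (1 / 2 + a), by positivity, fun f hf hL Q R hR m hm P hP i => ?_⟩
  refine (hC f hf hL R i).trans ?_
  have hle : b R ^ 2 ≤ E * μ.real (D.cube P) := by
    have h1 := (hdown r Q R hR).1
    have h2 := (hdown m Q P hP).2
    have h3 : b R ≤ K ^ r * K ^ M * b P := by
      calc b R ≤ K ^ r * b Q := h1
        _ ≤ K ^ r * (K ^ m * b P) := mul_le_mul_of_nonneg_left h2 (by positivity)
        _ ≤ K ^ r * (K ^ M * b P) := by
            have := (hb P).le
            gcongr
        _ = _ := by ring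
    calc b R ^ 2 ≤ (K ^ r * K ^ M * b P) ^ 2 := pow_le_pow_left₀ (hb R).le h3 2
      _ = (K ^ r * K ^ M) ^ 2 * b P ^ 2 := by ring
      _ ≤ (K ^ r * K ^ M) ^ 2 * (K * μ.real (D.cube P)) :=
          mul_le_mul_of_nonneg_left (hbm P) (by positivity)
      _ = _ := by rw [hE]; ring
  calc C * (D.lipSeminorm μ 1 a f).toReal * (b R ^ 2) ^ (1 / 2 + a)
      ≤ C * (D.lipSeminorm μ 1 a f).toReal * (E * μ.real (D.cube P)) ^ (1 / 2 + a) := by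
        gcongr
    _ = _ := by
        rw [Real.mul_rpow (by positivity) measureReal_nonneg]
        ring

end HaarSystem

/-! ### Terms of a Haar shift and the $L^2$ bound for finite parts -/

namespace HaarSystem

open DyadicSystem

variable {n : ℕ} {D : DyadicSystem n} {μ : Measure (Fin n → ℝ)} (H : HaarSystem D μ)

/-- The Haar functions as elements of `L²(μ)`. -/
noncomputable def haarLp (hμ : D.IsNondegenerate μ) (p : CubeIndex n × Fin (2 ^ n - 1)) :
    Lp ℝ 2 μ :=
  (H.memLp_h hμ 2 p.1 p.2).toLp _

theorem inner_haarLp (hμ : D.IsNondegenerate μ) (p : CubeIndex n × Fin (2 ^ n - 1))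
    (f : Lp ℝ 2 μ) : inner ℝ (H.haarLp hμ p) f = ∫ x, f x * H.h p.1 p.2 x ∂μ := by
  rw [L2.inner_def]
  refine integral_congr_ae ?_
  filter_upwards [(H.memLp_h hμ 2 p.1 p.2).coeFn_toLp] with x hx
  rw [haarLp, hx]
  simp

theorem orthonormal_haarLp (hμ : D.IsNondegenerate μ) : Orthonormal ℝ (H.haarLp hμ) := by
  classical
  rw [orthonormal_iff_ite]
  intro p p'
  have e : inner ℝ (H.haarLp hμ p) (H.haarLp hμ p')
      = ∫ x, H.h p'.1 p'.2 x * H.h p.1 p.2 x ∂μ := by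
    rw [H.inner_haarLp hμ]
    refine integral_congr_ae ?_
    filter_upwards [(H.memLp_h hμ 2 p'.1 p'.2).coeFn_toLp] with x hx
    rw [haarLp, hx]
  rw [e]
  split_ifs with h
  · rw [h, H.normalized]
  · exact H.orthogonal _ _ _ _ fun h' => h h'.symm

variable {r s : ℕ} {α : Coeff n}

theorem shiftTerm_congr {f g : (Fin n → ℝ) → ℝ} {Q : CubeIndex n}
    (h : ∀ R ∈ D.descendants r Q, ∀ i,
      ∫ x, f x * H.h R i x ∂μ = ∫ x, g x * H.h R i x ∂μ) :
    H.shiftTerm r s α f Q = H.shiftTerm r s α g Q := by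
  funext x
  refine Finset.sum_congr rfl fun R hR => Finset.sum_congr rfl fun S _ =>
    Finset.sum_congr rfl fun i _ => Finset.sum_congr rfl fun j _ => ?_
  rw [h R hR i]

theorem shiftTerm_eq_zero {f : (Fin n → ℝ) → ℝ} {Q : CubeIndex n}
    (h : ∀ R ∈ D.descendants r Q, ∀ i, ∫ x, f x * H.h R i x ∂μ = 0) (x : Fin n → ℝ) :
    H.shiftTerm r s α f Q x = 0 := by
  refine Finset.sum_eq_zero fun R hR => Finset.sum_eq_zero fun S _ =>
    Finset.sum_eq_zero fun i _ => Finset.sum_eq_zero fun j _ => ?_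
  rw [h R hR i, mul_zero, zero_mul]

theorem shiftTerm_of_notMem (f : (Fin n → ℝ) → ℝ) {Q : CubeIndex n} {x : Fin n → ℝ}
    (hx : x ∉ D.cube Q) : H.shiftTerm r s α f Q x = 0 := by
  refine Finset.sum_eq_zero fun R _ => Finset.sum_eq_zero fun S hS =>
    Finset.sum_eq_zero fun i _ => Finset.sum_eq_zero fun j _ => ?_
  rw [H.support S j x fun h => hx ((D.mem_descendants.1 hS).2 h), mul_zero]

theorem shiftTerm_eq_of_mem_cube (f : (Fin n → ℝ) → ℝ) {P Q : CubeIndex n}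
    (hg : Q.1 + s < P.1) {x : Fin n → ℝ} (hx : x ∈ D.cube P) :
    H.shiftTerm r s α f Q x = H.shiftTerm r s α f Q (D.corner P) := by
  refine Finset.sum_congr rfl fun R _ => Finset.sum_congr rfl fun S hS =>
    Finset.sum_congr rfl fun i _ => Finset.sum_congr rfl fun j _ => ?_
  rw [H.h_eq_of_mem_cube (by rwa [(D.mem_descendants.1 hS).1]) j hx]

theorem memLp_shiftTerm (hμ : D.IsNondegenerate μ) (p : ℝ≥0∞) (f : (Fin n → ℝ) → ℝ)
    (Q : CubeIndex n) : MemLp (H.shiftTerm r s α f Q) p μ :=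
  memLp_finsetSum _ fun _ _ => memLp_finsetSum _ fun S _ => memLp_finsetSum _ fun _ _ =>
    memLp_finsetSum _ fun j _ => (H.memLp_h hμ p S j).const_mul _

theorem integrable_shiftTerm (hμ : D.IsNondegenerate μ) (f : (Fin n → ℝ) → ℝ)
    (Q : CubeIndex n) : Integrable (H.shiftTerm r s α f Q) μ :=
  memLp_one_iff_integrable.1 (H.memLp_shiftTerm hμ 1 f Q)

theorem mean_shiftTerm_eq_zero (hμ : D.IsNondegenerate μ) (f : (Fin n → ℝ) → ℝ)
    {P Q : CubeIndex n} (hg : P.1 ≤ Q.1 + s) : D.mean μ (H.shiftTerm r s α f Q) P = 0 := by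
  have h_int : ∀ S j (c : ℝ), IntegrableOn (fun x => c * H.h S j x) (D.cube P) μ :=
    fun S j c => ((H.integrable_h hμ S j).const_mul c).integrableOn
  have h : ∫ x in D.cube P, H.shiftTerm r s α f Q x ∂μ = 0 := by
    simp only [shiftTerm]
    rw [integral_finsetSum _ fun R _ => integrable_finsetSum _ fun S _ =>
      integrable_finsetSum _ fun i _ => integrable_finsetSum _ fun j _ => h_int S j _]
    refine Finset.sum_eq_zero fun R _ => ?_
    rw [integral_finsetSum _ fun S _ =>
      integrable_finsetSum _ fun i _ => integrable_finsetSum _ fun j _ => h_int S j _]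
    refine Finset.sum_eq_zero fun S hS => ?_
    rw [integral_finsetSum _ fun i _ => integrable_finsetSum _ fun j _ => h_int S j _]
    refine Finset.sum_eq_zero fun i _ => ?_
    rw [integral_finsetSum _ fun j _ => h_int S j _]
    refine Finset.sum_eq_zero fun j _ => ?_
    rw [integral_const_mul, H.setIntegral_h_eq_zero (by rwa [(D.mem_descendants.1 hS).1]),
      mul_zero]
  rw [mean, setAverage_eq, h, smul_zero]

theorem mean_shiftTerm_eq_of_lt (hμ : D.IsNondegenerate μ) (f : (Fin n → ℝ) → ℝ)
    {P Q : CubeIndex n} (hg : Q.1 + s < P.1) {x : Fin n → ℝ} (hx : x ∈ D.cube P) :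
    D.mean μ (H.shiftTerm r s α f Q) P = H.shiftTerm r s α f Q x := by
  rw [mean, setAverage_eq, setIntegral_congr_fun (g := fun _ => H.shiftTerm r s α f Q x)
    (D.measurableSet_cube P) fun y hy => by
      simp only [H.shiftTerm_eq_of_mem_cube f hg hy, H.shiftTerm_eq_of_mem_cube f hg hx],
    setIntegral_const, smul_smul, inv_mul_cancel₀ (measureReal_cube_pos hμ P).ne', one_smul]

theorem eq_of_mem_descendants {Q Q' R : CubeIndex n} (h : R ∈ D.descendants r Q)
    (h' : R ∈ D.descendants r Q') : Q = Q' := by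
  have h1 := D.mem_descendants.1 h
  have h2 := D.mem_descendants.1 h'
  exact D.eq_of_mem_cube (by omega) (h1.2 (D.corner_mem_cube R)) (h2.2 (D.corner_mem_cube R))

/-- A finite part of a Haar shift is the whole shift applied to a Haar projection. -/
theorem eLpNorm_sum_shiftTerm_le (hμ : D.IsNondegenerate μ) {T : Lp ℝ 2 μ →L[ℝ] Lp ℝ 2 μ}
    (hT : H.IsShiftOnL2 r s α T) (f : (Fin n → ℝ) → ℝ) (G : Finset (CubeIndex n)) :
    eLpNorm (fun x => ∑ Q ∈ G, H.shiftTerm r s α f Q x) 2 μ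
      ≤ ‖T‖ₑ * ENNReal.ofReal
        (√(∑ Q ∈ G, ∑ R ∈ D.descendants r Q, ∑ i, (∫ x, f x * H.h R i x ∂μ) ^ 2)) := by
  classical
  set I : Finset (CubeIndex n × Fin (2 ^ n - 1)) := (G.biUnion (D.descendants r)) ×ˢ Finset.univ
    with hI
  set c : CubeIndex n × Fin (2 ^ n - 1) → ℝ := fun p => ∫ x, f x * H.h p.1 p.2 x ∂μ with hc
  set φ : Lp ℝ 2 μ := ∑ p ∈ I, c p • H.haarLp hμ p with hφ
  have hon := H.orthonormal_haarLp hμ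
  have hin : ∀ p, ∫ x, φ x * H.h p.1 p.2 x ∂μ = if p ∈ I then c p else 0 := by
    intro p
    rw [← H.inner_haarLp hμ, hφ, inner_sum]
    simp only [inner_smul_right, orthonormal_iff_ite.1 hon, mul_ite, mul_one, mul_zero]
    rw [Finset.sum_ite_eq]
  -- Distinct `Q` have disjoint sets of `r`-th descendants, so the terms outside `G` see only
  -- vanishing coefficients of `φ`. The partial sums of the series for $T\varphi$ are therefore
  -- constant once they include `G`.
  have hsum : ∀ F : Finset (CubeIndex n), G ⊆ F → ∀ x,
      ∑ Q ∈ F, H.shiftTerm r s α φ Q x = ∑ Q ∈ G, H.shiftTerm r s α f Q x := by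
    intro F hF x
    rw [← Finset.sum_subset hF]
    · refine Finset.sum_congr rfl fun Q hQ => ?_
      rw [H.shiftTerm_congr fun R hR i => ?_]
      have hmem : (R, i) ∈ I :=
        Finset.mem_product.2 ⟨Finset.mem_biUnion.2 ⟨Q, hQ, hR⟩, Finset.mem_univ _⟩
      have := hin (R, i)
      rwa [if_pos hmem] at this
    · intro Q _ hQ
      refine H.shiftTerm_eq_zero (fun R hR i => ?_) x
      have hmem : (R, i) ∉ I := by
        intro h
        obtain ⟨Q', hQ', hR'⟩ := Finset.mem_biUnion.1 (Finset.mem_product.1 h).1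
        exact hQ (eq_of_mem_descendants hR hR' ▸ hQ')
      have := hin (R, i)
      rwa [if_neg hmem] at this
  have hlim : Tendsto (fun _ : Finset (CubeIndex n) =>
      eLpNorm (fun x => (∑ Q ∈ G, H.shiftTerm r s α f Q x) - T φ x) 2 μ) atTop (𝓝 0) := by
    refine (hT φ).congr' ?_
    filter_upwards [eventually_ge_atTop G] with F hF
    exact congrArg (fun u => eLpNorm u 2 μ) (funext fun x => by rw [hsum F hF x])
  have h0 := tendsto_nhds_unique hlim tendsto_const_nhds
  have hmeas : AEStronglyMeasurable (fun x => ∑ Q ∈ G, H.shiftTerm r s α f Q x) μ :=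
    (memLp_finsetSum G fun Q _ => H.memLp_shiftTerm hμ 2 f Q).1
  have hae : (fun x => ∑ Q ∈ G, H.shiftTerm r s α f Q x) =ᵐ[μ] T φ := by
    have h1 := (eLpNorm_eq_zero_iff (hmeas.sub (Lp.aestronglyMeasurable (T φ)))
      two_ne_zero).1 h0.symm
    filter_upwards [h1] with x hx
    exact sub_eq_zero.1 hx
  have hnorm : ‖φ‖ = √(∑ Q ∈ G, ∑ R ∈ D.descendants r Q, ∑ i, (∫ x, f x * H.h R i x ∂μ) ^ 2) := by
    have h1 : ‖φ‖ ^ 2 = ∑ p ∈ I, c p ^ 2 := by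
      rw [← real_inner_self_eq_norm_sq, hφ, hon.inner_sum]
      exact Finset.sum_congr rfl fun p _ => by simp [pow_two]
    have h2 : ∑ p ∈ I, c p ^ 2
        = ∑ Q ∈ G, ∑ R ∈ D.descendants r Q, ∑ i, (∫ x, f x * H.h R i x ∂μ) ^ 2 := by
      rw [hI, Finset.sum_product, Finset.sum_biUnion]
      intro Q _ Q' _ hne
      exact Finset.disjoint_left.2 fun R h h' => hne (eq_of_mem_descendants h h')
    rw [← h2, ← h1, Real.sqrt_sq (norm_nonneg _)]
  rw [eLpNorm_congr_ae hae, ← hnorm, ofReal_norm, ← Lp.enorm_def]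
  exact T.le_opENorm φ

end HaarSystem

/-! ### Uniform Lipschitz bounds for finite parts -/

namespace HaarSystem

open DyadicSystem

variable {n : ℕ} {D : DyadicSystem n} {μ : Measure (Fin n → ℝ)} (H : HaarSystem D μ)
variable {r s : ℕ} {α : Coeff n}

/-- All output Haar functions of a term live in the single generation `Q.1 + s`. Relative to `P`
they are therefore either all of mean zero or all constant. -/
theorem shiftTerm_sub_mean (hμ : D.IsNondegenerate μ) (f : (Fin n → ℝ) → ℝ) {P : CubeIndex n}
    (Q : CubeIndex n) {x : Fin n → ℝ} (hx : x ∈ D.cube P) :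
    H.shiftTerm r s α f Q x - D.mean μ (H.shiftTerm r s α f Q) P
      = if P.1 ≤ Q.1 + s then H.shiftTerm r s α f Q x else 0 := by
  split_ifs with h
  · rw [H.mean_shiftTerm_eq_zero hμ f h, sub_zero]
  · rw [H.mean_shiftTerm_eq_of_lt hμ f (not_le.1 h) hx, sub_self]

theorem mean_sum_shiftTerm (hμ : D.IsNondegenerate μ) (f : (Fin n → ℝ) → ℝ)
    (F : Finset (CubeIndex n)) (P : CubeIndex n) :
    D.mean μ (fun x => ∑ Q ∈ F, H.shiftTerm r s α f Q x) P
      = ∑ Q ∈ F, D.mean μ (H.shiftTerm r s α f Q) P := by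
  simp only [mean, setAverage_eq]
  rw [integral_finsetSum _ fun Q _ => (H.integrable_shiftTerm hμ f Q).integrableOn,
    Finset.smul_sum]

theorem integrable_sum_shiftTerm (hμ : D.IsNondegenerate μ) (f : (Fin n → ℝ) → ℝ)
    (F : Finset (CubeIndex n)) : Integrable (fun x => ∑ Q ∈ F, H.shiftTerm r s α f Q x) μ :=
  integrable_finsetSum _ fun Q _ => H.integrable_shiftTerm hμ f Q

theorem memLp_indicator_sub_mean_parent (hμ : D.IsNondegenerate μ) {a : ℝ}
    {f : (Fin n → ℝ) → ℝ} (hf : ∀ Q, IntegrableOn f (D.cube Q) μ) (P : CubeIndex n)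
    (hL : D.lipSeminorm μ 2 a f ≠ ∞) :
    MemLp ((D.cube P).indicator fun x => f x - D.mean μ f (D.parent P)) 2 μ ∧
    eLpNorm ((D.cube P).indicator fun x => f x - D.mean μ f (D.parent P)) 2 μ
      ≤ D.lipSeminorm μ 2 a f * μ (D.cube P) ^ (1 / 2 + a) := by
  have hle := rpow_lintegral_le_lipSeminorm hμ 2 a f P
  have heq : eLpNorm ((D.cube P).indicator fun x => f x - D.mean μ f (D.parent P)) 2 μ
      = (∫⁻ x in D.cube P, ‖f x - D.mean μ f (D.parent P)‖ₑ ^ (2 : ℝ) ∂μ) ^ (1 / (2 : ℝ)) := by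
    rw [eLpNorm_indicator_eq_eLpNorm_restrict (D.measurableSet_cube P),
      eLpNorm_eq_lintegral_rpow_enorm_toReal two_ne_zero ENNReal.ofNat_ne_top]
    simp
  rw [heq]
  refine ⟨⟨?_, ?_⟩, hle⟩
  · exact (aestronglyMeasurable_indicator_iff (D.measurableSet_cube P)).2
      ((hf P).aestronglyMeasurable.sub aestronglyMeasurable_const)
  · rw [heq]
    exact hle.trans_lt (ENNReal.mul_lt_top hL.lt_top
      (ENNReal.rpow_ne_top_of_ne_zero (hμ P).1.ne' (hμ P).2.ne).lt_top)

theorem integral_indicator_sub_mul_h (hμ : D.IsNondegenerate μ) {f : (Fin n → ℝ) → ℝ}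
    {P R : CubeIndex n} (hf : IntegrableOn f (D.cube P) μ) (hR : D.cube R ⊆ D.cube P)
    (c : ℝ) (i : Fin (2 ^ n - 1)) :
    ∫ x, (D.cube P).indicator (fun x => f x - c) x * H.h R i x ∂μ = ∫ x, f x * H.h R i x ∂μ := by
  rw [H.integral_mul_h_eq_setIntegral _ hR, H.integral_mul_h_eq_setIntegral f hR,
    setIntegral_congr_fun (g := fun x => f x * H.h R i x - c * H.h R i x)
      (D.measurableSet_cube P) fun x hx => by
        simp only [Set.indicator_of_mem hx]; ring,
    integral_sub (H.integrableOn_mul_h hf i)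
      ((H.integrable_h hμ R i).const_mul c).integrableOn, integral_const_mul]
  have : ∫ x in D.cube P, H.h R i x ∂μ = 0 := by
    rw [setIntegral_eq_integral_of_forall_compl_eq_zero, H.integral_eq_zero]
    exact fun x hx => H.support R i x fun hxS => hx (hR hxS)
  rw [this, mul_zero, sub_zero]

/-- Haar functions inside $P$ do not see constants, so `f` may be replaced by $1_P(f-\langle
f\rangle_{\widehat P})$, whose $L^2$ norm the seminorm controls; then Bessel applies. -/
theorem sum_sq_integral_mul_h_le (hμ : D.IsNondegenerate μ) {a : ℝ}
    {f : (Fin n → ℝ) → ℝ} (hf : ∀ Q, IntegrableOn f (D.cube Q) μ) (P : CubeIndex n)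
    (hL : D.lipSeminorm μ 2 a f ≠ ∞) (r : ℕ) (G : Finset (CubeIndex n))
    (hG : ∀ Q ∈ G, D.cube Q ⊆ D.cube P) :
    ∑ Q ∈ G, ∑ R ∈ D.descendants r Q, ∑ i, (∫ x, f x * H.h R i x ∂μ) ^ 2
      ≤ ((D.lipSeminorm μ 2 a f).toReal * μ.real (D.cube P) ^ (1 / 2 + a)) ^ 2 := by
  classical
  obtain ⟨hmem, hle⟩ := memLp_indicator_sub_mean_parent hμ hf P hL
  set φ : Lp ℝ 2 μ := hmem.toLp _ with hφ
  have hφn : ‖φ‖ ≤ (D.lipSeminorm μ 2 a f).toReal * μ.real (D.cube P) ^ (1 / 2 + a) := by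
    rw [hφ, Lp.norm_toLp]
    have := ENNReal.toReal_mono (ENNReal.mul_ne_top hL
      (ENNReal.rpow_ne_top_of_ne_zero (hμ P).1.ne' (hμ P).2.ne)) hle
    rwa [ENNReal.toReal_mul, ← ENNReal.toReal_rpow] at this
  have hcoef : ∀ Q ∈ G, ∀ R ∈ D.descendants r Q, ∀ i,
      ∫ x, f x * H.h R i x ∂μ = inner ℝ (H.haarLp hμ (R, i)) φ := by
    intro Q hQ R hR i
    rw [H.inner_haarLp hμ, ← H.integral_indicator_sub_mul_h hμ (hf P)
      ((D.mem_descendants.1 hR).2.trans (hG Q hQ)) (D.mean μ f (D.parent P)) i]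
    refine integral_congr_ae ?_
    filter_upwards [hmem.coeFn_toLp] with x hx
    rw [hφ, hx]
  have hbessel := (H.orthonormal_haarLp hμ).sum_inner_products_le φ
    (s := (G.biUnion (D.descendants r)) ×ˢ Finset.univ)
  calc ∑ Q ∈ G, ∑ R ∈ D.descendants r Q, ∑ i, (∫ x, f x * H.h R i x ∂μ) ^ 2
      = ∑ p ∈ (G.biUnion (D.descendants r)) ×ˢ Finset.univ,
          ‖inner ℝ (H.haarLp hμ p) φ‖ ^ 2 := by
        rw [Finset.sum_product, Finset.sum_biUnion]
        · refine Finset.sum_congr rfl fun Q hQ => Finset.sum_congr rfl fun R hR =>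
            Finset.sum_congr rfl fun i _ => ?_
          rw [hcoef Q hQ R hR i, Real.norm_eq_abs, sq_abs]
        · intro Q _ Q' _ hne
          exact Finset.disjoint_left.2 fun R h h' => hne (eq_of_mem_descendants h h')
    _ ≤ ‖φ‖ ^ 2 := hbessel
    _ ≤ _ := pow_le_pow_left₀ (norm_nonneg _) hφn 2

/-- Finite parts of a Haar shift are bounded on `Λ_2(a)`, uniformly. -/
theorem exists_lipSeminorm_two_sum_shiftTerm_le (hn : 1 ≤ n) (hμ : D.IsNondegenerate μ)
    (hbal : H.Balanced) {a : ℝ} (ha : 0 < a) (r s : ℕ) :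
    ∃ C : ℝ≥0, ∀ (α : Coeff n) (T : Lp ℝ 2 μ →L[ℝ] Lp ℝ 2 μ), H.IsShiftOnL2 r s α T →
      ∀ f : (Fin n → ℝ) → ℝ, (∀ Q, IntegrableOn f (D.cube Q) μ) →
        D.lipSeminorm μ 2 a f ≠ ∞ → ∀ F : Finset (CubeIndex n),
          D.lipSeminorm μ 2 a (fun x => ∑ Q ∈ F, H.shiftTerm r s α f Q x)
            ≤ C * ‖T‖ₑ * D.lipSeminorm μ 2 a f := by
  classical
  obtain ⟨B, hB0, hB⟩ := H.exists_abs_integral_mul_h_le hn hμ hbal ha r (s + 1)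
  -- At most $s+1$ ancestors, $2^{nr}$ descendants of each, $2^n-1$ Haar functions per descendant,
  -- and $B^2$ for each squared coefficient.
  set N : ℝ := (s + 1) * (2 ^ (n * r) * ((2 ^ n - 1 : ℕ) * B ^ 2)) with hN
  have hN0 : 0 ≤ N := by positivity
  refine ⟨(√(1 + N)).toNNReal, fun α T hT f hf hL F => ?_⟩
  have hL1 : D.lipSeminorm μ 1 a f ≤ D.lipSeminorm μ 2 a f :=
    lipSeminorm_mono_exponent hμ one_pos one_le_two a hf
  have hL1' : D.lipSeminorm μ 1 a f ≠ ∞ := ne_top_of_le_ne_top hL hL1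
  rw [lipSeminorm_le_iff hμ]
  intro P
  set L := (D.lipSeminorm μ 2 a f).toReal with hLdef
  set W : ℝ := L * μ.real (D.cube P) ^ (1 / 2 + a) with hW
  have hW0 : 0 ≤ W := mul_nonneg ENNReal.toReal_nonneg (Real.rpow_nonneg measureReal_nonneg _)
  -- The terms that survive on `P`: those not constant on the parent, which has generation `P.1 -
  -- 1`, and whose cube meets `P`.
  set G := F.filter fun Q => P.1 - 1 ≤ Q.1 + s ∧ ¬ Disjoint (D.cube Q) (D.cube P) with hG
  have hpt : ∀ x ∈ D.cube P, (∑ Q ∈ F, H.shiftTerm r s α f Q x)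
      - D.mean μ (fun x => ∑ Q ∈ F, H.shiftTerm r s α f Q x) (D.parent P)
      = ∑ Q ∈ G, H.shiftTerm r s α f Q x := by
    intro x hx
    rw [H.mean_sum_shiftTerm hμ, ← Finset.sum_sub_distrib, hG, Finset.sum_filter]
    refine Finset.sum_congr rfl fun Q _ => ?_
    rw [H.shiftTerm_sub_mean hμ f Q (D.cube_subset_cube_parent P hx)]
    change (if P.1 - 1 ≤ Q.1 + s then _ else _) = _
    by_cases h1 : P.1 - 1 ≤ Q.1 + s
    · by_cases h2 : Disjoint (D.cube Q) (D.cube P)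
      · simp [h1, h2, H.shiftTerm_of_notMem f (Set.disjoint_right.1 h2 hx)]
      · simp [h1, h2]
    · simp [h1]
  -- Cubes inside `P` are handled by Bessel; there are too many of them for a termwise bound.
  have hfirst : ∑ Q ∈ G with P.1 ≤ Q.1, ∑ R ∈ D.descendants r Q, ∑ i,
      (∫ x, f x * H.h R i x ∂μ) ^ 2 ≤ W ^ 2 := by
    refine H.sum_sq_integral_mul_h_le hμ hf P hL r _ fun Q hQ => ?_
    obtain ⟨hQG, hg⟩ := Finset.mem_filter.1 hQ
    have h2 := (Finset.mem_filter.1 hQG).2.2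
    exact (D.disjoint_or_subset hg).resolve_left fun h => h2 h.symm
  have hanc : ∀ Q ∈ G.filter (fun Q => ¬ P.1 ≤ Q.1), D.corner P ∈ D.cube Q := by
    intro Q hQ
    obtain ⟨hQG, hg⟩ := Finset.mem_filter.1 hQ
    have h2 := (Finset.mem_filter.1 hQG).2.2
    exact ((D.disjoint_or_subset (not_le.1 hg).le).resolve_left h2) (D.corner_mem_cube P)
  -- Strict ancestors of `P` are determined by their generation, which lies in $[P_1-1-s,\,P_1)$
  -- with $P_1$ the generation of `P`.
  have hcard : ((G.filter fun Q => ¬ P.1 ≤ Q.1).card : ℝ) ≤ s + 1 := by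
    have h1 : (G.filter fun Q => ¬ P.1 ≤ Q.1).card ≤ (Finset.Ico (P.1 - 1 - s) P.1).card := by
      refine Finset.card_le_card_of_injOn Prod.fst (fun Q hQ => ?_) fun Q hQ Q' hQ' he =>
        D.eq_of_mem_cube he (hanc Q hQ) (hanc Q' hQ')
      obtain ⟨hQG, hg⟩ := Finset.mem_filter.1 hQ
      have h2 := (Finset.mem_filter.1 hQG).2.1
      exact Finset.mem_coe.2 (Finset.mem_Ico.2 ⟨by omega, by omega⟩)
    rw [Int.card_Ico] at h1
    have h2 : (P.1 - (P.1 - 1 - s)).toNat = s + 1 := by omega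
    rw [h2] at h1
    exact_mod_cast h1
  have hsecond : ∑ Q ∈ G with ¬ P.1 ≤ Q.1, ∑ R ∈ D.descendants r Q, ∑ i,
      (∫ x, f x * H.h R i x ∂μ) ^ 2 ≤ N * W ^ 2 := by
    have hterm : ∀ Q ∈ G.filter (fun Q => ¬ P.1 ≤ Q.1), ∑ R ∈ D.descendants r Q, ∑ i,
        (∫ x, f x * H.h R i x ∂μ) ^ 2 ≤ 2 ^ (n * r) * ((2 ^ n - 1 : ℕ) * (B * W) ^ 2) := by
      intro Q hQ
      have hcP := hanc Q hQ
      obtain ⟨hQG, hg⟩ := Finset.mem_filter.1 hQ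
      have h2 := (Finset.mem_filter.1 hQG).2.1
      have hP : P ∈ D.descendants (P.1 - Q.1).toNat Q :=
        mem_descendants_of_le (by omega) hcP (D.corner_mem_cube P)
      refine (Finset.sum_le_card_nsmul _ _ ((2 ^ n - 1 : ℕ) * (B * W) ^ 2) fun R hR => ?_).trans
        (by simp [D.card_descendants, nsmul_eq_mul])
      refine (Finset.sum_le_card_nsmul _ _ ((B * W) ^ 2) fun i _ => ?_).trans
        (by simp [nsmul_eq_mul])
      rw [← sq_abs]
      refine pow_le_pow_left₀ (abs_nonneg _) ?_ 2
      refine (hB f hf hL1' Q R hR _ (by omega) P hP i).trans ?_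
      rw [hW, ← mul_assoc]
      gcongr
      exact ENNReal.toReal_mono hL hL1
    refine (Finset.sum_le_card_nsmul _ _ _ hterm).trans ?_
    rw [nsmul_eq_mul]
    refine (mul_le_mul_of_nonneg_right hcard (by positivity)).trans (le_of_eq ?_)
    rw [hN]
    ring
  have htotal : √(∑ Q ∈ G, ∑ R ∈ D.descendants r Q, ∑ i, (∫ x, f x * H.h R i x ∂μ) ^ 2)
      ≤ √(1 + N) * W := by
    rw [← Finset.sum_filter_add_sum_filter_not G fun Q => P.1 ≤ Q.1]
    refine (Real.sqrt_le_sqrt (add_le_add hfirst hsecond)).trans (le_of_eq ?_)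
    rw [← one_add_mul, Real.sqrt_mul (by positivity), Real.sqrt_sq hW0]
  have hWe : ENNReal.ofReal W = D.lipSeminorm μ 2 a f * μ (D.cube P) ^ (1 / 2 + a) := by
    rw [hW, hLdef, measureReal_def, ENNReal.toReal_rpow, ← ENNReal.toReal_mul,
      ENNReal.ofReal_toReal]
    exact ENNReal.mul_ne_top hL (ENNReal.rpow_ne_top_of_ne_zero (hμ P).1.ne' (hμ P).2.ne)
  calc (∫⁻ x in D.cube P, ‖(∑ Q ∈ F, H.shiftTerm r s α f Q x)
        - D.mean μ (fun x => ∑ Q ∈ F, H.shiftTerm r s α f Q x) (D.parent P)‖ₑ ^ (2 : ℝ) ∂μ)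
          ^ (1 / (2 : ℝ))
      = (∫⁻ x in D.cube P, ‖∑ Q ∈ G, H.shiftTerm r s α f Q x‖ₑ ^ (2 : ℝ) ∂μ) ^ (1 / (2 : ℝ)) := by
        congr 1
        exact setLIntegral_congr_fun (D.measurableSet_cube P) fun x hx => by
          simp only [hpt x hx]
    _ ≤ (∫⁻ x, ‖∑ Q ∈ G, H.shiftTerm r s α f Q x‖ₑ ^ (2 : ℝ) ∂μ) ^ (1 / (2 : ℝ)) := by
        gcongr
        exact Measure.restrict_le_self
    _ = eLpNorm (fun x => ∑ Q ∈ G, H.shiftTerm r s α f Q x) 2 μ := by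
        rw [eLpNorm_eq_lintegral_rpow_enorm_toReal two_ne_zero ENNReal.ofNat_ne_top]
        simp
    _ ≤ ‖T‖ₑ * ENNReal.ofReal
        (√(∑ Q ∈ G, ∑ R ∈ D.descendants r Q, ∑ i, (∫ x, f x * H.h R i x ∂μ) ^ 2)) :=
        H.eLpNorm_sum_shiftTerm_le hμ hT f G
    _ ≤ ‖T‖ₑ * ENNReal.ofReal (√(1 + N) * W) := by gcongr
    _ = ((√(1 + N)).toNNReal : ℝ≥0∞) * ‖T‖ₑ * D.lipSeminorm μ 2 a f
          * μ (D.cube P) ^ (1 / 2 + a) := by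
        rw [ENNReal.ofReal_mul (by positivity), hWe, ENNReal.ofReal]
        ring

/-- Finite parts of a Haar shift are bounded on `Λ_q(a)`, uniformly. -/
theorem exists_lipSeminorm_sum_shiftTerm_le (hn : 1 ≤ n) (hμ : D.IsNondegenerate μ)
    (hbal : H.Balanced) {a : ℝ} (ha : 0 < a) (r s : ℕ) {p : ℝ} (hp : 0 < p) :
    ∃ C : ℝ≥0, ∀ (α : Coeff n) (T : Lp ℝ 2 μ →L[ℝ] Lp ℝ 2 μ), H.IsShiftOnL2 r s α T →
      ∀ f : (Fin n → ℝ) → ℝ, (∀ Q, IntegrableOn f (D.cube Q) μ) →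
        D.lipSeminorm μ 1 a f ≠ ∞ → ∀ F : Finset (CubeIndex n),
          D.lipSeminorm μ p a (fun x => ∑ Q ∈ F, H.shiftTerm r s α f Q x)
            ≤ C * ‖T‖ₑ * D.lipSeminorm μ 1 a f := by
  obtain ⟨C, hC⟩ := H.exists_lipSeminorm_two_sum_shiftTerm_le hn hμ hbal ha r s
  obtain ⟨K₂, hK₂⟩ := exists_lipSeminorm_le_mul_lipSeminorm_one hμ two_pos ha.le
  obtain ⟨K, hK⟩ := exists_lipSeminorm_le_mul_lipSeminorm_one hμ hp ha.le
  refine ⟨K * (C * K₂), fun α T hT f hf hL F => ?_⟩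
  have hF : ∀ P, IntegrableOn (fun x => ∑ Q ∈ F, H.shiftTerm r s α f Q x) (D.cube P) μ :=
    fun P => (H.integrable_sum_shiftTerm hμ f F).integrableOn
  have hL2 : D.lipSeminorm μ 2 a f ≠ ∞ :=
    ne_top_of_le_ne_top (ENNReal.mul_ne_top ENNReal.coe_ne_top hL) (hK₂ f hf)
  -- John–Nirenberg is used twice: on the output, to go from exponent 1 to `p`, and on the input, to
  -- go from exponent 1 to 2.
  calc D.lipSeminorm μ p a (fun x => ∑ Q ∈ F, H.shiftTerm r s α f Q x)
      ≤ K * D.lipSeminorm μ 1 a (fun x => ∑ Q ∈ F, H.shiftTerm r s α f Q x) := hK _ hF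
    _ ≤ K * D.lipSeminorm μ 2 a (fun x => ∑ Q ∈ F, H.shiftTerm r s α f Q x) := by
        gcongr
        exact lipSeminorm_mono_exponent hμ one_pos one_le_two a hF
    _ ≤ K * (C * ‖T‖ₑ * D.lipSeminorm μ 2 a f) := by
        gcongr
        exact hC α T hT f hf hL2 F
    _ ≤ K * (C * ‖T‖ₑ * (K₂ * D.lipSeminorm μ 1 a f)) := by
        gcongr
        exact hK₂ f hf
    _ = _ := by push_cast; ring

end HaarSystem

/-! ### From $L^2$ convergence to $L^q$ convergence -/

theorem eLpNorm_ofReal_eq {Ω : Type*} [MeasurableSpace Ω] {ν : Measure Ω} {p : ℝ} (hp : 0 < p)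
    (u : Ω → ℝ) :
    eLpNorm u (ENNReal.ofReal p) ν = (∫⁻ x, ‖u x‖ₑ ^ p ∂ν) ^ (1 / p) := by
  rw [eLpNorm_eq_lintegral_rpow_enorm_toReal (by simpa using hp) ENNReal.ofReal_ne_top,
    ENNReal.toReal_ofReal hp.le]

/-- Convergence in `L²` of a family bounded in every `L^p` is convergence in every `L^q`. -/
theorem tendsto_eLpNorm_of_tendsto_two {Ω ι : Type*} [MeasurableSpace Ω] {ν : Measure Ω}
    [IsFiniteMeasure ν] {l : Filter ι} [l.NeBot] [l.IsCountablyGenerated] {u : ι → Ω → ℝ}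
    {v : Ω → ℝ} (hu : ∀ i, AEStronglyMeasurable (u i) ν) (hv : AEStronglyMeasurable v ν)
    (h : Tendsto (fun i => eLpNorm (fun x => u i x - v x) 2 ν) l (𝓝 0))
    (hB : ∀ p : ℝ, 0 < p → ∃ B : ℝ≥0∞, B ≠ ∞ ∧ ∀ i, ∫⁻ x, ‖u i x‖ₑ ^ p ∂ν ≤ B)
    {q : ℝ} (hq : 0 < q) :
    MemLp v (ENNReal.ofReal q) ν ∧
      Tendsto (fun i => eLpNorm (fun x => u i x - v x) (ENNReal.ofReal q) ν) l (𝓝 0) := by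
  have hfatou : ∀ p : ℝ, 0 < p → ∃ B : ℝ≥0∞, B ≠ ∞ ∧ (∀ i, ∫⁻ x, ‖u i x‖ₑ ^ p ∂ν ≤ B) ∧
      ∫⁻ x, ‖v x‖ₑ ^ p ∂ν ≤ B := by
    intro p hp
    obtain ⟨B, hBtop, hB⟩ := hB p hp
    exact ⟨B, hBtop, hB, lintegral_enorm_rpow_le_of_tendsto hu hv two_ne_zero h hB⟩
  constructor
  · obtain ⟨B, hBtop, -, hvB⟩ := hfatou q hq
    refine ⟨hv, ?_⟩
    rw [eLpNorm_ofReal_eq hq]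
    exact ENNReal.rpow_lt_top_of_nonneg (by positivity) (ne_top_of_le_ne_top hBtop hvB)
  -- It suffices to treat an exponent $M\ge\max(q,2)$, the measure being finite. By Cauchy–Schwarz,
  -- $\int|w|^M\le\|w\|_2\,(\int|w|^{2(M-1)})^{1/2}$: the first factor tends to zero, the second is
  -- bounded.
  set M : ℝ := max q 2 with hM
  have hM2 : 2 ≤ M := le_max_right _ _
  have hM0 : 0 < M := by linarith
  obtain ⟨B, hBtop, huB, hvB⟩ := hfatou (2 * (M - 1)) (by linarith)
  set E : ℝ≥0∞ := 2 ^ (2 * (M - 1) - 1) * (B + B) with hE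
  have hEtop : E ≠ ∞ := ENNReal.mul_ne_top
    (ENNReal.rpow_ne_top_of_nonneg (by linarith) ENNReal.ofNat_ne_top)
    (ENNReal.add_ne_top.2 ⟨hBtop, hBtop⟩)
  have hw : ∀ i, ∫⁻ x, ‖u i x - v x‖ₑ ^ (2 * (M - 1)) ∂ν ≤ E := by
    intro i
    calc ∫⁻ x, ‖u i x - v x‖ₑ ^ (2 * (M - 1)) ∂ν
        ≤ ∫⁻ x, 2 ^ (2 * (M - 1) - 1) *
            (‖u i x‖ₑ ^ (2 * (M - 1)) + ‖v x‖ₑ ^ (2 * (M - 1))) ∂ν := by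
          refine lintegral_mono fun x => ?_
          refine le_trans ?_ (ENNReal.rpow_add_le_mul_rpow_add_rpow _ _ (by linarith))
          exact ENNReal.rpow_le_rpow (enorm_sub_le) (by linarith)
      _ = 2 ^ (2 * (M - 1) - 1) *
            (∫⁻ x, ‖u i x‖ₑ ^ (2 * (M - 1)) ∂ν + ∫⁻ x, ‖v x‖ₑ ^ (2 * (M - 1)) ∂ν) := by
          have hm : AEMeasurable
              (fun x => ‖u i x‖ₑ ^ (2 * (M - 1)) + ‖v x‖ₑ ^ (2 * (M - 1))) ν :=
            ((hu i).enorm.pow_const _).add (hv.enorm.pow_const _)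
          rw [lintegral_const_mul'' _ hm, lintegral_add_left' ((hu i).enorm.pow_const _)]
      _ ≤ E := by
          rw [hE]
          gcongr
          exact huB i
  have hinterp : ∀ i, eLpNorm (fun x => u i x - v x) (ENNReal.ofReal M) ν
      ≤ (eLpNorm (fun x => u i x - v x) 2 ν * E ^ (1 / (2 : ℝ))) ^ (1 / M) := by
    intro i
    have hmeas : AEMeasurable (fun x => ‖u i x - v x‖ₑ) ν := ((hu i).sub hv).enorm
    rw [eLpNorm_ofReal_eq hM0]
    refine ENNReal.rpow_le_rpow ?_ (by positivity)
    calc ∫⁻ x, ‖u i x - v x‖ₑ ^ M ∂ν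
        = ∫⁻ x, ((fun x => ‖u i x - v x‖ₑ) * fun x => ‖u i x - v x‖ₑ ^ (M - 1)) x ∂ν := by
          refine lintegral_congr fun x => ?_
          simp only [Pi.mul_apply]
          have := ENNReal.rpow_add_of_nonneg (x := ‖u i x - v x‖ₑ) 1 (M - 1) zero_le_one
            (by linarith)
          rwa [ENNReal.rpow_one, add_sub_cancel] at this
      _ ≤ (∫⁻ x, ‖u i x - v x‖ₑ ^ (2 : ℝ) ∂ν) ^ (1 / (2 : ℝ)) *
            (∫⁻ x, (‖u i x - v x‖ₑ ^ (M - 1)) ^ (2 : ℝ) ∂ν) ^ (1 / (2 : ℝ)) :=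
          ENNReal.lintegral_mul_le_Lp_mul_Lq ν Real.HolderConjugate.two_two hmeas
            (hmeas.pow_const _)
      _ ≤ _ := by
          rw [eLpNorm_eq_lintegral_rpow_enorm_toReal two_ne_zero ENNReal.ofNat_ne_top]
          simp only [ENNReal.toReal_ofNat, ← ENNReal.rpow_mul]
          gcongr
          rw [mul_comm (M - 1) 2]
          exact hw i
  have hMlim : Tendsto (fun i => eLpNorm (fun x => u i x - v x) (ENNReal.ofReal M) ν) l (𝓝 0) := by
    have h1 : Tendsto (fun i => (eLpNorm (fun x => u i x - v x) 2 ν * E ^ (1 / (2 : ℝ))) ^ (1 / M))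
        l (𝓝 ((0 * E ^ (1 / (2 : ℝ))) ^ (1 / M))) :=
      (ENNReal.continuous_rpow_const.tendsto _).comp (ENNReal.Tendsto.mul_const h
        (Or.inr (ENNReal.rpow_ne_top_of_nonneg (by positivity) hEtop)))
    rw [zero_mul, ENNReal.zero_rpow_of_pos (by positivity)] at h1
    exact tendsto_of_tendsto_of_tendsto_of_le_of_le tendsto_const_nhds h1 (fun _ => zero_le) hinterp
  have hqM : ENNReal.ofReal q ≤ ENNReal.ofReal M := ENNReal.ofReal_le_ofReal (le_max_left _ _)
  set e : ℝ := 1 / (ENNReal.ofReal q).toReal - 1 / (ENNReal.ofReal M).toReal with he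
  have he0 : 0 ≤ e := by
    rw [he, ENNReal.toReal_ofReal hq.le, ENNReal.toReal_ofReal hM0.le, sub_nonneg]
    exact one_div_le_one_div_of_le hq (le_max_left _ _)
  have h2 := ENNReal.Tendsto.mul_const (b := ν Set.univ ^ e) hMlim
    (Or.inr (ENNReal.rpow_ne_top_of_nonneg he0 (measure_ne_top ν _)))
  rw [zero_mul] at h2
  exact tendsto_of_tendsto_of_tendsto_of_le_of_le tendsto_const_nhds h2 (fun _ => zero_le)
    fun i => eLpNorm_le_eLpNorm_mul_rpow_measure_univ hqM ((hu i).sub hv)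

/-! ### Convergence modulo constants and gluing -/

namespace DyadicSystem

variable {n : ℕ} {D : DyadicSystem n} {μ : Measure (Fin n → ℝ)}

theorem mean_sub (hμ : D.IsNondegenerate μ) {f : (Fin n → ℝ) → ℝ} {P : CubeIndex n}
    (hf : IntegrableOn f (D.cube P) μ) (c : ℝ) :
    D.mean μ (fun x => f x - c) P = D.mean μ f P - c := by
  have h := mean_sub_mul hμ hf c
  rw [← mean_mul hμ] at h
  exact (mul_right_cancel₀ (measureReal_cube_pos hμ P).ne' h).symm

/-- The mean over `P` is a contraction of $L^e(P)$, by Hölder. -/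
theorem eLpNorm_sub_mean_le (hμ : D.IsNondegenerate μ) {e : ℝ≥0∞} (he : 1 ≤ e)
    {w : (Fin n → ℝ) → ℝ} {P : CubeIndex n} (hw : IntegrableOn w (D.cube P) μ) :
    eLpNorm (fun x => w x - D.mean μ w P) e (μ.restrict (D.cube P))
      ≤ 2 * eLpNorm w e (μ.restrict (D.cube P)) := by
  have h0 := (hμ P).1.ne'
  have h1 := (hμ P).2.ne
  have hne : μ.restrict (D.cube P) ≠ 0 := by
    intro h
    have := congrArg (fun ν : Measure (Fin n → ℝ) => ν Set.univ) h
    simp only [Measure.restrict_apply_univ, Measure.coe_zero, Pi.zero_apply] at this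
    exact h0 this
  have hconst : eLpNorm (fun _ : Fin n → ℝ => D.mean μ w P) e (μ.restrict (D.cube P))
      ≤ eLpNorm w e (μ.restrict (D.cube P)) := by
    rw [eLpNorm_const _ (zero_lt_one.trans_le he).ne' hne, Measure.restrict_apply_univ]
    have h2 := enorm_mean_sub_mul_le hμ hw 0
    simp only [sub_zero] at h2
    rw [← eLpNorm_one_eq_lintegral_enorm] at h2
    have h3 := h2.trans (eLpNorm_le_eLpNorm_mul_rpow_measure_univ he hw.aestronglyMeasurable)
    rw [Measure.restrict_apply_univ, ENNReal.toReal_one, div_one] at h3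
    have h4 : ‖D.mean μ w P‖ₑ * μ (D.cube P) ^ (1 / e.toReal) * μ (D.cube P) ^ (1 - 1 / e.toReal)
        ≤ eLpNorm w e (μ.restrict (D.cube P)) * μ (D.cube P) ^ (1 - 1 / e.toReal) := by
      rw [mul_assoc, ← ENNReal.rpow_add _ _ h0 h1, add_sub_cancel, ENNReal.rpow_one]
      exact h3
    exact (ENNReal.mul_le_mul_iff_left (ENNReal.rpow_pos (hμ P).1 h1).ne'
      (ENNReal.rpow_ne_top_of_ne_zero h0 h1)).1 h4
  calc eLpNorm (fun x => w x - D.mean μ w P) e (μ.restrict (D.cube P))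
      ≤ eLpNorm w e (μ.restrict (D.cube P))
        + eLpNorm (fun _ => D.mean μ w P) e (μ.restrict (D.cube P)) :=
        eLpNorm_sub_le hw.aestronglyMeasurable aestronglyMeasurable_const he
    _ ≤ 2 * eLpNorm w e (μ.restrict (D.cube P)) := by
        rw [two_mul]
        gcongr

variable (D μ) in
/-- `u i → g` in `L^e(P, μ)`, up to additive constants depending on `i`. -/
def TendstoModConst {ι : Type*} (l : Filter ι) (e : ℝ≥0∞) (u : ι → (Fin n → ℝ) → ℝ)
    (g : (Fin n → ℝ) → ℝ) (P : CubeIndex n) : Prop :=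
  ∃ k : ι → ℝ, Tendsto (fun i => eLpNorm (fun x => u i x - k i - g x) e (μ.restrict (D.cube P)))
    l (𝓝 0)

variable {ι : Type*} {l : Filter ι} {e : ℝ≥0∞} {u : ι → (Fin n → ℝ) → ℝ}

theorem TendstoModConst.mono {g : (Fin n → ℝ) → ℝ} {P R : CubeIndex n}
    (h : D.TendstoModConst μ l e u g P) (hR : D.cube R ⊆ D.cube P) :
    D.TendstoModConst μ l e u g R := by
  obtain ⟨k, hk⟩ := h
  exact ⟨k, tendsto_of_tendsto_of_tendsto_of_le_of_le tendsto_const_nhds hk (fun _ => zero_le)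
    fun i => eLpNorm_mono_measure _ (Measure.restrict_mono hR le_rfl)⟩

theorem TendstoModConst.congr_sub_const {g g' : (Fin n → ℝ) → ℝ} {P : CubeIndex n}
    (h : D.TendstoModConst μ l e u g P) (c : ℝ)
    (hg : ∀ᵐ x ∂μ.restrict (D.cube P), g' x = g x - c) :
    D.TendstoModConst μ l e u g' P := by
  obtain ⟨k, hk⟩ := h
  refine ⟨fun i => k i + c, hk.congr fun i => eLpNorm_congr_ae ?_⟩
  filter_upwards [hg] with x hx
  rw [hx]
  ring

/-- Whatever constants realise the convergence, the means may replace them at the cost of a factor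
2. -/
theorem TendstoModConst.tendsto_sub_mean (hμ : D.IsNondegenerate μ) (he : 1 ≤ e)
    {g : (Fin n → ℝ) → ℝ} {P : CubeIndex n} (h : D.TendstoModConst μ l e u g P)
    (hu : ∀ i, IntegrableOn (u i) (D.cube P) μ) (hg : IntegrableOn g (D.cube P) μ) :
    Tendsto (fun i => eLpNorm (fun x => (u i x - D.mean μ (u i) P) - (g x - D.mean μ g P)) e
      (μ.restrict (D.cube P))) l (𝓝 0) := by
  obtain ⟨k, hk⟩ := h
  have h2 := ENNReal.Tendsto.const_mul (a := 2) hk (Or.inr ENNReal.ofNat_ne_top)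
  rw [mul_zero] at h2
  refine tendsto_of_tendsto_of_tendsto_of_le_of_le tendsto_const_nhds h2 (fun _ => zero_le)
    fun i => ?_
  have hc := integrableOn_const_cube hμ P (k i)
  have h_int : IntegrableOn (fun x => u i x - k i) (D.cube P) μ := (hu i).sub hc
  refine le_trans (le_of_eq ?_) (eLpNorm_sub_mean_le hμ he (h_int.sub hg))
  congr 1
  funext x
  have e1 : D.mean μ (fun x => u i x - k i - g x) P = D.mean μ (u i) P - k i - D.mean μ g P := by
    rw [← mean_sub hμ (hu i) (k i)]
    simp only [mean, setAverage_eq]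
    rw [integral_sub h_int hg, smul_sub]
  rw [e1]
  ring

/-- Uniqueness of the limit up to a constant, which makes the local limits compatible for gluing. -/
theorem TendstoModConst.exists_ae_eq_sub_const [l.NeBot] (hμ : D.IsNondegenerate μ) (he : 1 ≤ e)
    {g g' : (Fin n → ℝ) → ℝ} {P : CubeIndex n} (h : D.TendstoModConst μ l e u g P)
    (h' : D.TendstoModConst μ l e u g' P) (hu : ∀ i, IntegrableOn (u i) (D.cube P) μ)
    (hg : IntegrableOn g (D.cube P) μ) (hg' : IntegrableOn g' (D.cube P) μ) :
    ∀ᵐ x ∂μ.restrict (D.cube P), g x - D.mean μ g P = g' x - D.mean μ g' P := by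
  have h1 := h.tendsto_sub_mean hμ he hu hg
  have h2 := h'.tendsto_sub_mean hμ he hu hg'
  have h3 := h2.add h1
  rw [add_zero] at h3
  have hm : ∀ v : (Fin n → ℝ) → ℝ, IntegrableOn v (D.cube P) μ →
      AEStronglyMeasurable (fun x => v x - D.mean μ v P) (μ.restrict (D.cube P)) :=
    fun v hv => hv.aestronglyMeasurable.sub aestronglyMeasurable_const
  have h4 : eLpNorm (fun x => (g x - D.mean μ g P) - (g' x - D.mean μ g' P)) e
      (μ.restrict (D.cube P)) ≤ 0 := by
    refine ge_of_tendsto h3 (Eventually.of_forall fun i => ?_)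
    refine le_trans (le_of_eq ?_) (eLpNorm_sub_le ((hm _ (hu i)).sub (hm _ hg'))
      ((hm _ (hu i)).sub (hm _ hg)) he)
    congr 1
    funext x
    simp only [Pi.sub_apply]
    ring
  have h5 := (eLpNorm_eq_zero_iff ((hm _ hg).sub (hm _ hg')) (zero_lt_one.trans_le he).ne').1
    (nonpos_iff_eq_zero.1 h4)
  filter_upwards [h5] with x hx
  exact sub_eq_zero.1 hx

theorem ae_restrict_of_subset {A B : Set (Fin n → ℝ)} (h : A ⊆ B) {p : (Fin n → ℝ) → Prop}
    (hp : ∀ᵐ x ∂μ.restrict B, p x) : ∀ᵐ x ∂μ.restrict A, p x :=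
  ae_mono (Measure.restrict_mono h le_rfl) hp

/-- Limits up to constants on the individual cubes can be glued to one function. -/
theorem exists_tendstoModConst [l.NeBot] (hμ : D.IsNondegenerate μ) (he : 1 ≤ e)
    (hu : ∀ i P, IntegrableOn (u i) (D.cube P) μ)
    (h : ∀ P, ∃ g, MemLp g e (μ.restrict (D.cube P)) ∧ D.TendstoModConst μ l e u g P) :
    ∃ g, ∀ P, MemLp g e (μ.restrict (D.cube P)) ∧ D.TendstoModConst μ l e u g P := by
  choose G hG hlim using h
  have hfin := isFiniteMeasure_restrict_cube hμ
  have hGint : ∀ P, IntegrableOn (G P) (D.cube P) μ := fun P => (hG P).integrable he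
  -- Two local limits differ by a constant on the smaller cube; normalising both by the mean over a
  -- common subcube `B` removes it.
  have hcons : ∀ V A B : CubeIndex n, D.cube V ⊆ D.cube A → D.cube B ⊆ D.cube V →
      ∀ᵐ x ∂μ.restrict (D.cube V), G V x - D.mean μ (G V) B = G A x - D.mean μ (G A) B := by
    intro V A B hVA hBV
    have hAV := (hGint A).mono_set hVA
    have h1 := (hlim V).exists_ae_eq_sub_const hμ he ((hlim A).mono hVA) (fun i => hu i V)
      (hGint V) hAV
    have h2 : D.mean μ (G V) B = D.mean μ (G A) B
        - (D.mean μ (G A) V - D.mean μ (G V) V) := by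
      rw [← mean_sub hμ ((hGint A).mono_set (hBV.trans hVA))]
      simp only [mean, setAverage_eq]
      congr 1
      refine integral_congr_ae ?_
      filter_upwards [ae_restrict_of_subset hBV h1] with x hx
      simp only [mean, setAverage_eq] at hx
      linarith
    filter_upwards [h1] with x hx
    rw [h2]
    linarith
  let W : (Fin n → ℤ) → CubeIndex n := fun j => (0, j)
  -- Unit cubes need not have a common ancestor (the system may split into quadrants), so constants
  -- are fixed separately in each class of unit cubes that do have one.
  let rel : Setoid (Fin n → ℤ) :=
    { r := fun j j' => ∃ V : CubeIndex n, V.1 ≤ 0 ∧ D.cube (W j) ⊆ D.cube V ∧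
        D.cube (W j') ⊆ D.cube V
      iseqv :=
        { refl := fun j => ⟨W j, le_rfl, subset_rfl, subset_rfl⟩
          symm := fun ⟨V, h0, h1, h2⟩ => ⟨V, h0, h2, h1⟩
          trans := by
            rintro j j' j'' ⟨V, h0, h1, h2⟩ ⟨V', h0', h1', h2'⟩
            have hc := D.corner_mem_cube (W j')
            rcases le_total V.1 V'.1 with hg | hg
            · exact ⟨V, h0, h1, h2'.trans (D.cube_subset_of_mem hg (h2 hc) (h1' hc))⟩
            · exact ⟨V', h0', h1.trans (D.cube_subset_of_mem hg (h1' hc) (h2 hc)), h2'⟩ } }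
  -- Each class gets one base cube `W (β j)`. The function `g` is the local limit on a cube `A j`
  -- containing both `W j` and the base cube, normalised to have mean zero on the latter.
  let β : (Fin n → ℤ) → (Fin n → ℤ) := fun j => (Quotient.mk rel j).out
  have hβ : ∀ j, rel.r j (β j) := fun j => rel.symm (Quotient.exact (Quotient.out_eq _))
  choose A hA0 hAj hAβ using hβ
  let g : (Fin n → ℝ) → ℝ := fun x =>
    let j := (D.cubeAt 0 x).2
    G (A j) x - D.mean μ (G (A j)) (W (β j))
  refine ⟨g, fun P => ?_⟩
  -- The cubes `P` and `A j₀` share the corner of `P`, hence are nested; `V` is the larger. It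
  -- contains the base cube `B`, which is common to all unit cubes in `V`.
  obtain ⟨V, B, hV0, hPV, hBV, hβV⟩ : ∃ V B : CubeIndex n, V.1 ≤ 0 ∧ D.cube P ⊆ D.cube V ∧
      D.cube B ⊆ D.cube V ∧ ∀ j, D.cube (W j) ⊆ D.cube V → W (β j) = B := by
    set j₀ := (D.cubeAt 0 (D.corner P)).2 with hj₀
    have hx₀ : D.corner P ∈ D.cube (W j₀) := D.mem_cube_cubeAt 0 _
    have hcP := D.corner_mem_cube P
    have hcA := hAj j₀ hx₀
    have key : ∀ V : CubeIndex n, V.1 ≤ 0 → D.cube (A j₀) ⊆ D.cube V → ∀ j,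
        D.cube (W j) ⊆ D.cube V → W (β j) = W (β j₀) := by
      intro V hV0 hAV j hj
      have : rel.r j j₀ := ⟨V, hV0, hj, (hAj j₀).trans hAV⟩
      simp only [β]
      rw [Quotient.sound (s := rel) this]
    rcases le_total P.1 (A j₀).1 with hg | hg
    · have hAP := D.cube_subset_of_mem hg hcP hcA
      exact ⟨P, W (β j₀), hg.trans (hA0 j₀), subset_rfl, (hAβ j₀).trans hAP,
        key P (hg.trans (hA0 j₀)) hAP⟩
    · exact ⟨A j₀, W (β j₀), hA0 j₀, D.cube_subset_of_mem hg hcA hcP, hAβ j₀,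
        key _ (hA0 j₀) subset_rfl⟩
  have hae : ∀ᵐ x ∂μ.restrict (D.cube V), g x = G V x - D.mean μ (G V) B := by
    rw [D.cube_eq_biUnion (-V.1).toNat V, ae_restrict_biUnion_finset_iff]
    intro R hR
    obtain ⟨hR1, hRV⟩ := D.mem_descendants.1 hR
    obtain ⟨k, j⟩ := R
    have hk : k = 0 := by
      simp only at hR1
      omega
    subst hk
    have hB := hβV j hRV
    have hBA : D.cube B ⊆ D.cube (A j) := hB ▸ hAβ j
    have hcB := D.corner_mem_cube B
    have h1 : ∀ᵐ x ∂μ.restrict (D.cube (0, j)),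
        G (A j) x - D.mean μ (G (A j)) B = G V x - D.mean μ (G V) B := by
      -- Both cubes contain `B`, so they are nested, and `hcons` applies in one of the two orders.
      rcases le_total V.1 (A j).1 with hg | hg
      · exact ae_restrict_of_subset (hAj j)
          (hcons (A j) V B (D.cube_subset_of_mem hg (hBV hcB) (hBA hcB)) hBA)
      · filter_upwards [ae_restrict_of_subset hRV
          (hcons V (A j) B (D.cube_subset_of_mem hg (hBA hcB) (hBV hcB)) hBV)] with x hx
        exact hx.symm
    filter_upwards [h1, ae_restrict_mem (D.measurableSet_cube (0, j))] with x hx hxj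
    have hj : (D.cubeAt 0 x).2 = j := congrArg Prod.snd (D.cubeAt_eq hxj)
    simp only [g, hj, hB]
    exact hx
  have hmem : MemLp g e (μ.restrict (D.cube V)) :=
    ((hG V).sub (memLp_const (D.mean μ (G V) B))).ae_eq (by
      filter_upwards [hae] with x hx
      rw [hx]
      rfl)
  exact ⟨hmem.mono_measure (Measure.restrict_mono hPV le_rfl),
    ((hlim V).congr_sub_const _ hae).mono hPV⟩

end DyadicSystem

/-! ### Passage to the limit in Lipschitz seminorms -/

namespace DyadicSystem

variable {n : ℕ} {D : DyadicSystem n} {μ : Measure (Fin n → ℝ)}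

/-- The seminorm subtracts the mean over the parent, so it is applied on the children of `P`. -/
theorem lintegral_sub_mean_rpow_le (hμ : D.IsNondegenerate μ) {p : ℝ} (hp : 0 < p) {a : ℝ}
    {v : (Fin n → ℝ) → ℝ} {L : ℝ≥0∞} (hL : D.lipSeminorm μ p a v ≤ L) (P : CubeIndex n) :
    ∫⁻ x in D.cube P, ‖v x - D.mean μ v P‖ₑ ^ p ∂μ
      ≤ ∑ R ∈ D.descendants 1 P, (L * μ (D.cube R) ^ (1 / p + a)) ^ p := by
  rw [D.lintegral_cube_eq_sum μ 1 P]
  refine Finset.sum_le_sum fun R hR => ?_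
  have h := (lipSeminorm_le_iff hμ).1 hL R
  rw [D.parent_of_mem_descendants hR] at h
  have h' := ENNReal.rpow_le_rpow h hp.le
  rwa [← ENNReal.rpow_mul, one_div_mul_cancel hp.ne', ENNReal.rpow_one] at h'

/-- Lower semicontinuity by Fatou. Convergence is taken on the parent of `P`, so that the correct
mean is subtracted, and then restricted to `P`. -/
theorem lipSeminorm_le_of_tendsto (hμ : D.IsNondegenerate μ) {ι : Type*} {l : Filter ι} [l.NeBot]
    [l.IsCountablyGenerated] {e : ℝ≥0∞} (he : e ≠ 0) {p : ℝ} (hp : 0 < p) {a : ℝ}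
    {u : ι → (Fin n → ℝ) → ℝ} {g : (Fin n → ℝ) → ℝ} (hu : ∀ i P, IntegrableOn (u i) (D.cube P) μ)
    (hg : ∀ P, IntegrableOn g (D.cube P) μ)
    (h : ∀ P, Tendsto (fun i => eLpNorm
      (fun x => (u i x - D.mean μ (u i) P) - (g x - D.mean μ g P)) e (μ.restrict (D.cube P))) l
        (𝓝 0))
    {L : ℝ≥0∞} (hL : ∀ i, D.lipSeminorm μ p a (u i) ≤ L) : D.lipSeminorm μ p a g ≤ L := by
  rw [lipSeminorm_le_iff hμ]
  intro P
  have h1 : Tendsto (fun i => eLpNorm (fun x => (u i x - D.mean μ (u i) (D.parent P))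
      - (g x - D.mean μ g (D.parent P))) e (μ.restrict (D.cube P))) l (𝓝 0) :=
    tendsto_of_tendsto_of_tendsto_of_le_of_le tendsto_const_nhds (h (D.parent P))
      (fun _ => zero_le) fun i =>
        eLpNorm_mono_measure _ (Measure.restrict_mono (D.cube_subset_cube_parent P) le_rfl)
  have h2 := lintegral_enorm_rpow_le_of_tendsto (p := p)
    (B := (L * μ (D.cube P) ^ (1 / p + a)) ^ p)
    (fun i => (hu i P).aestronglyMeasurable.sub aestronglyMeasurable_const)
    ((hg P).aestronglyMeasurable.sub aestronglyMeasurable_const) he h1 fun i => by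
      have h' := ENNReal.rpow_le_rpow ((lipSeminorm_le_iff hμ).1 (hL i) P) hp.le
      rwa [← ENNReal.rpow_mul, one_div_mul_cancel hp.ne', ENNReal.rpow_one] at h'
  have h3 := ENNReal.rpow_le_rpow h2 (one_div_nonneg.2 hp.le)
  rwa [← ENNReal.rpow_mul, mul_one_div_cancel hp.ne', ENNReal.rpow_one] at h3

/-- For a family bounded in `Λ_p(a)` for every `p`, local convergence in `L²` up to constants is
local convergence in `L^q` up to constants. -/
theorem TendstoModConst.of_two (hμ : D.IsNondegenerate μ) {ι : Type*} {l : Filter ι} [l.NeBot]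
    [l.IsCountablyGenerated] {a : ℝ} {u : ι → (Fin n → ℝ) → ℝ} {g : (Fin n → ℝ) → ℝ}
    {P : CubeIndex n} (h : D.TendstoModConst μ l 2 u g P)
    (hu : ∀ i, IntegrableOn (u i) (D.cube P) μ) (hg : IntegrableOn g (D.cube P) μ)
    (hL : ∀ p : ℝ, 0 < p → ∃ L : ℝ≥0∞, L ≠ ∞ ∧ ∀ i, D.lipSeminorm μ p a (u i) ≤ L)
    {q : ℝ} (hq : 0 < q) :
    MemLp g (ENNReal.ofReal q) (μ.restrict (D.cube P)) ∧
      D.TendstoModConst μ l (ENNReal.ofReal q) u g P := by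
  have := isFiniteMeasure_restrict_cube hμ P
  have h1 := tendsto_eLpNorm_of_tendsto_two
    (fun i => (hu i).aestronglyMeasurable.sub aestronglyMeasurable_const)
    (hg.aestronglyMeasurable.sub aestronglyMeasurable_const)
    (h.tendsto_sub_mean hμ one_le_two hu hg) (fun p hp => by
      obtain ⟨L, hLtop, hL⟩ := hL p hp
      refine ⟨_, ?_, fun i => lintegral_sub_mean_rpow_le hμ hp (hL i) P⟩
      refine ENNReal.sum_ne_top.2 fun R _ => ENNReal.rpow_ne_top_of_nonneg hp.le ?_
      exact ENNReal.mul_ne_top hLtop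
        (ENNReal.rpow_ne_top_of_ne_zero (hμ R).1.ne' (hμ R).2.ne)) hq
  constructor
  · have h2 := h1.1.add (memLp_const (D.mean μ g P))
    convert h2 using 1
    funext x
    simp
  · refine ⟨fun i => D.mean μ (u i) P - D.mean μ g P, h1.2.congr fun i => ?_⟩
    congr 1
    funext x
    simp only [Pi.sub_apply]
    ring

end DyadicSystem

/-! ### Local convergence of the shift series -/

namespace HaarSystem

open DyadicSystem

variable {n : ℕ} {D : DyadicSystem n} {μ : Measure (Fin n → ℝ)} (H : HaarSystem D μ)
variable {r s : ℕ} {α : Coeff n}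

theorem sum_shiftTerm_sub_mean (hμ : D.IsNondegenerate μ) (f : (Fin n → ℝ) → ℝ)
    (F : Finset (CubeIndex n)) (P : CubeIndex n) (x : Fin n → ℝ) :
    ∑ Q ∈ F, (H.shiftTerm r s α f Q x - ⨍ y in D.cube P, H.shiftTerm r s α f Q y ∂μ)
      = (∑ Q ∈ F, H.shiftTerm r s α f Q x)
        - D.mean μ (fun x => ∑ Q ∈ F, H.shiftTerm r s α f Q x) P := by
  rw [H.mean_sum_shiftTerm hμ, Finset.sum_sub_distrib]

theorem isShiftImage_of_tendstoModConst (hμ : D.IsNondegenerate μ) {q : ℝ} (hq : 1 ≤ q)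
    {f g : (Fin n → ℝ) → ℝ}
    (h : ∀ P, MemLp g (ENNReal.ofReal q) (μ.restrict (D.cube P)) ∧
      D.TendstoModConst μ atTop (ENNReal.ofReal q)
        (fun (F : Finset (CubeIndex n)) x => ∑ Q ∈ F, H.shiftTerm r s α f Q x) g P) :
    H.IsShiftImage r s α q f g := by
  have hg : D.MemLqLoc μ q g := fun P => (h P).1
  refine ⟨hg, fun P => ?_⟩
  simp_rw [H.sum_shiftTerm_sub_mean hμ]
  exact (h P).2.tendsto_sub_mean hμ (by simpa using ENNReal.ofReal_le_ofReal hq)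
    (fun F => (H.integrable_sum_shiftTerm hμ f F).integrableOn) (hg.integrableOn hμ hq P)

/-- On every cube, the series of the shift converges in `L²` up to constants. -/
theorem exists_tendstoModConst_two (hμ : D.IsNondegenerate μ)
    {T : Lp ℝ 2 μ →L[ℝ] Lp ℝ 2 μ} (hT : H.IsShiftOnL2 r s α T) {a : ℝ} {f : (Fin n → ℝ) → ℝ}
    (hf : ∀ Q, IntegrableOn f (D.cube Q) μ) (hL : D.lipSeminorm μ 2 a f ≠ ∞) (P : CubeIndex n) :
    ∃ g : Lp ℝ 2 μ, D.TendstoModConst μ atTop 2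
      (fun (F : Finset (CubeIndex n)) x => ∑ Q ∈ F, H.shiftTerm r s α f Q x) g P := by
  classical
  obtain ⟨hmem, -⟩ := memLp_indicator_sub_mean_parent hμ hf P hL
  set φ : Lp ℝ 2 μ := hmem.toLp _ with hφ
  set τ : ((Fin n → ℝ) → ℝ) → CubeIndex n → Lp ℝ 2 μ := fun f Q =>
    (H.memLp_shiftTerm hμ 2 f Q : MemLp (H.shiftTerm r s α f Q) 2 μ).toLp _ with hτ
  have hcoe : ∀ (w : CubeIndex n → (Fin n → ℝ) → ℝ) (hw : ∀ Q, MemLp (w Q) 2 μ)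
      (F : Finset (CubeIndex n)),
      ⇑(∑ Q ∈ F, (hw Q).toLp (w Q)) =ᵐ[μ] fun x => ∑ Q ∈ F, w Q x := by
    intro w hw F
    have h1 : ∀ᵐ x ∂μ, ∀ Q ∈ F, ((hw Q).toLp (w Q)) x = w Q x :=
      (F.eventually_all).2 fun Q _ => (hw Q).coeFn_toLp
    filter_upwards [Lp.coeFn_finsetSum F fun Q => (hw Q).toLp (w Q), h1] with x hx1 hx2
    rw [hx1, Finset.sum_apply]
    exact Finset.sum_congr rfl hx2
  -- With `φ` the localisation of `f` to `P`, the hypothesis on `T` gives an unconditionally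
  -- convergent series; any subfamily of it, in particular the cubes inside `P`, is again summable.
  have hsumφ : Summable (τ φ) := by
    refine ⟨T φ, ?_⟩
    rw [HasSum, SummationFilter.unconditional_filter, Lp.tendsto_Lp_iff_tendsto_eLpNorm']
    refine (hT φ).congr fun F => eLpNorm_congr_ae ?_
    filter_upwards [hcoe (H.shiftTerm r s α φ) (fun Q => H.memLp_shiftTerm hμ 2 φ Q) F] with x hx
    simp only [hτ, Pi.sub_apply, hx]
  set inner : Set (CubeIndex n) := {Q | P.1 ≤ Q.1 ∧ D.cube Q ⊆ D.cube P} with hinner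
  -- The strict ancestors of `P` whose terms are not constant on `P`: at most one in each of `s`
  -- generations.
  set outer : Finset (CubeIndex n) :=
    (Finset.Ico (P.1 - s) P.1).image fun k => D.cubeAt k (D.corner P) with houter
  have hτφ : ∀ Q ∈ inner, H.shiftTerm r s α φ Q = H.shiftTerm r s α f Q := by
    intro Q hQ
    refine H.shiftTerm_congr fun R hR i => ?_
    rw [← H.integral_indicator_sub_mul_h hμ (hf P)
      ((D.mem_descendants.1 hR).2.trans hQ.2) (D.mean μ f (D.parent P)) i]
    refine integral_congr_ae ?_
    filter_upwards [hmem.coeFn_toLp] with x hx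
    rw [hφ, hx]
  -- On `P`, `w Q` equals the centred term of `f`. Inside `P` it uses `φ`, which has the same
  -- coefficients there.
  set w : CubeIndex n → (Fin n → ℝ) → ℝ := fun Q =>
    (if Q ∈ inner then H.shiftTerm r s α φ Q else 0) +
      if Q ∈ outer then H.shiftTerm r s α f Q else 0 with hw
  have hwi : ∀ Q, MemLp (if Q ∈ inner then H.shiftTerm r s α φ Q else 0) 2 μ := by
    intro Q
    split_ifs
    · exact H.memLp_shiftTerm hμ 2 _ Q
    · exact MemLp.zero
  have hwo : ∀ Q, MemLp (if Q ∈ outer then H.shiftTerm r s α f Q else 0) 2 μ := by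
    intro Q
    split_ifs
    · exact H.memLp_shiftTerm hμ 2 _ Q
    · exact MemLp.zero
  have hwm : ∀ Q, MemLp (w Q) 2 μ := fun Q => (hwi Q).add (hwo Q)
  have hsum : Summable fun Q => (hwm Q).toLp (w Q) := by
    have h1 : Summable (inner.indicator (τ φ)) := hsumφ.indicator inner
    have h2 : Summable fun Q => (hwo Q).toLp _ := by
      refine summable_of_ne_finset_zero (s := outer) fun Q hQ => ?_
      simp only [hQ, if_false]
      exact MemLp.toLp_zero _
    refine (h1.add h2).congr fun Q => ?_
    rw [show (hwm Q).toLp (w Q) = (hwi Q).toLp _ + (hwo Q).toLp _ from MemLp.toLp_add _ _]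
    congr 1
    by_cases hQ : Q ∈ inner
    · simp only [hQ, if_true, Set.indicator_of_mem hQ, hτ]
    · simp only [hQ, if_false, Set.indicator_of_notMem hQ]
      exact (MemLp.toLp_zero _).symm
  obtain ⟨g, hg⟩ := hsum
  rw [HasSum, SummationFilter.unconditional_filter, Lp.tendsto_Lp_iff_tendsto_eLpNorm'] at hg
  refine ⟨g, fun F => D.mean μ (fun x => ∑ Q ∈ F, H.shiftTerm r s α f Q x) P, ?_⟩
  refine tendsto_of_tendsto_of_tendsto_of_le_of_le tendsto_const_nhds hg (fun _ => zero_le) ?_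
  intro F
  refine le_trans (le_of_eq ?_)
    (eLpNorm_mono_measure _ (Measure.restrict_le_self (s := D.cube P)))
  refine eLpNorm_congr_ae ?_
  filter_upwards [ae_restrict_of_ae (hcoe w hwm F), ae_restrict_mem (D.measurableSet_cube P)]
    with x hx hxP
  rw [Pi.sub_apply, hx, ← H.sum_shiftTerm_sub_mean hμ]
  congr 1
  refine Finset.sum_congr rfl fun Q _ => ?_
  rw [H.shiftTerm_sub_mean hμ f Q hxP]
  have hnot : Q ∈ inner → Q ∉ outer := by
    intro h1 h2
    obtain ⟨k, hk, rfl⟩ := Finset.mem_image.1 h2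
    have h3 := h1.1
    simp only [cubeAt] at h3
    exact absurd (Finset.mem_Ico.1 hk).2 (not_lt.2 h3)
  simp only [hw, Pi.add_apply]
  by_cases hxQ : x ∈ D.cube Q
  · by_cases h1 : P.1 ≤ Q.1
    · have hin : Q ∈ inner := ⟨h1, D.cube_subset_of_mem h1 hxP hxQ⟩
      rw [if_pos (by omega), if_pos hin, if_neg (hnot hin), hτφ Q hin]
      simp
    · have hin : Q ∉ inner := fun h => h1 h.1
      have hcQ : D.cubeAt Q.1 (D.corner P) = Q :=
        D.cubeAt_eq (D.cube_subset_of_mem (not_le.1 h1).le hxQ hxP (D.corner_mem_cube P))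
      by_cases h2 : P.1 ≤ Q.1 + s
      · have hout : Q ∈ outer :=
          Finset.mem_image.2 ⟨Q.1, Finset.mem_Ico.2 ⟨by omega, not_le.1 h1⟩, hcQ⟩
        simp [h2, hin, hout]
      · have hout : Q ∉ outer := by
          intro h
          obtain ⟨k, hk, hkQ⟩ := Finset.mem_image.1 h
          have h3 : k = Q.1 := congrArg Prod.fst hkQ
          have h4 := (Finset.mem_Ico.1 hk).1
          omega
        simp [h2, hin, hout]
  · have h1 := H.shiftTerm_of_notMem (r := r) (s := s) (α := α) f hxQ
    have h2 := H.shiftTerm_of_notMem (r := r) (s := s) (α := α) φ hxQ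
    split_ifs <;> simp [h1, h2]

end HaarSystem

/-! ### The theorem -/

theorem theoremB {n : ℕ} (hn : 1 ≤ n) (D : DyadicSystem n) (μ : Measure (Fin n → ℝ))
    (hμ : ∀ Q : CubeIndex n, 0 < μ (D.cube Q) ∧ μ (D.cube Q) < ∞)
    (H : HaarSystem D μ) (hbal : H.Balanced)
    (r s : ℕ) (q a : ℝ) (hq : 1 < q) (ha : 0 < a) :
    ∃ C : ℝ≥0, ∀ (α : HaarSystem.Coeff n) (T : Lp ℝ 2 μ →L[ℝ] Lp ℝ 2 μ),
      H.IsShiftOnL2 r s α T →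
        -- on `L² ∩ Λ_q(a)`, the image defined through local convergence is the original `T f`
        (∀ f : Lp ℝ 2 μ, D.MemLip μ q a f → H.IsShiftImage r s α q f (T f)) ∧
        ∀ f : (Fin n → ℝ) → ℝ, D.MemLip μ q a f →
          (∃ g, H.IsShiftImage r s α q f g) ∧
          ∀ g, H.IsShiftImage r s α q f g →
            D.MemLip μ q a g ∧
              D.lipSeminorm μ q a g ≤ C * ‖T‖ₑ * D.lipSeminorm μ q a f := by
  have hq0 : 0 < q := by linarith
  have hqe : 1 ≤ ENNReal.ofReal q := by simpa using ENNReal.ofReal_le_ofReal hq.le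
  obtain ⟨C, hC⟩ := H.exists_lipSeminorm_sum_shiftTerm_le hn hμ hbal ha r s hq0
  refine ⟨C, fun α T hT => ?_⟩
  have h_int : ∀ (f : (Fin n → ℝ) → ℝ) (F : Finset (CubeIndex n)) (P : CubeIndex n),
      IntegrableOn (fun x => ∑ Q ∈ F, H.shiftTerm r s α f Q x) (D.cube P) μ :=
    fun f F P => (H.integrable_sum_shiftTerm hμ f F).integrableOn
  have hfin := DyadicSystem.isFiniteMeasure_restrict_cube hμ
  have hLp : ∀ (g : Lp ℝ 2 μ) (P : CubeIndex n), IntegrableOn g (D.cube P) μ := fun g P =>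
    ((Lp.memLp g).mono_measure Measure.restrict_le_self).integrable one_le_two
  have hf1 : ∀ f : (Fin n → ℝ) → ℝ, D.MemLip μ q a f →
      D.lipSeminorm μ 1 a f ≤ D.lipSeminorm μ q a f := fun f hf =>
    DyadicSystem.lipSeminorm_mono_exponent hμ one_pos hq.le a (hf.1.integrableOn hμ hq.le)
  -- Bounds for every exponent are needed, not only `q`: the upgrade from $L^2$ to $L^q$ uses
  -- $2(\max(q,2)-1)$.
  have hbound : ∀ f : (Fin n → ℝ) → ℝ, D.MemLip μ q a f → ∀ p : ℝ, 0 < p →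
      ∃ L : ℝ≥0∞, L ≠ ∞ ∧ ∀ F : Finset (CubeIndex n),
        D.lipSeminorm μ p a (fun x => ∑ Q ∈ F, H.shiftTerm r s α f Q x) ≤ L := by
    intro f hf p hp
    obtain ⟨C', hC'⟩ := H.exists_lipSeminorm_sum_shiftTerm_le hn hμ hbal ha r s hp
    have hL1 : D.lipSeminorm μ 1 a f ≠ ∞ := ((hf1 f hf).trans_lt hf.2).ne
    exact ⟨_, ENNReal.mul_ne_top (ENNReal.mul_ne_top ENNReal.coe_ne_top enorm_ne_top) hL1,
      hC' α T hT f (hf.1.integrableOn hμ hq.le) hL1⟩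
  refine ⟨fun f hf => ?_, fun f hf => ⟨?_, fun g hg => ?_⟩⟩
  · refine H.isShiftImage_of_tendstoModConst hμ hq.le fun P => ?_
    -- For $f\in L^2$ the series converges globally, so no constants have to be subtracted.
    refine DyadicSystem.TendstoModConst.of_two hμ (a := a) ⟨fun _ => 0, ?_⟩ (fun F => h_int f F P)
      (hLp (T f) P) (hbound f hf) hq0
    simp only [sub_zero]
    exact tendsto_of_tendsto_of_tendsto_of_le_of_le tendsto_const_nhds (hT f) (fun _ => zero_le)
      fun F => eLpNorm_mono_measure _ Measure.restrict_le_self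
  · have hfi := hf.1.integrableOn hμ hq.le
    obtain ⟨K, hK⟩ := DyadicSystem.exists_lipSeminorm_le_mul_lipSeminorm_one hμ two_pos ha.le
    have hL2 : D.lipSeminorm μ 2 a f ≠ ∞ := ne_top_of_le_ne_top
      (ENNReal.mul_ne_top ENNReal.coe_ne_top ((hf1 f hf).trans_lt hf.2).ne) (hK f hfi)
    obtain ⟨g, hg⟩ := DyadicSystem.exists_tendstoModConst hμ hqe
      (u := fun (F : Finset (CubeIndex n)) x => ∑ Q ∈ F, H.shiftTerm r s α f Q x) (l := atTop)
      (h_int f) fun P => by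
        obtain ⟨g, hg⟩ := H.exists_tendstoModConst_two hμ hT hfi hL2 P
        exact ⟨g, hg.of_two hμ (fun F => h_int f F P) (hLp g P) (hbound f hf) hq0⟩
    exact ⟨g, H.isShiftImage_of_tendstoModConst hμ hq.le hg⟩
  · obtain ⟨hgloc, hlim⟩ := hg
    have hle : D.lipSeminorm μ q a g ≤ C * ‖T‖ₑ * D.lipSeminorm μ q a f := by
      refine DyadicSystem.lipSeminorm_le_of_tendsto hμ (zero_lt_one.trans_le hqe).ne' hq0
        (u := fun (F : Finset (CubeIndex n)) x => ∑ Q ∈ F, H.shiftTerm r s α f Q x) (l := atTop)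
        (h_int f) (hgloc.integrableOn hμ hq.le) (fun P => ?_) fun F => ?_
      · have h := hlim P
        simp_rw [H.sum_shiftTerm_sub_mean hμ] at h
        exact h
      · refine (hC α T hT f (hf.1.integrableOn hμ hq.le)
          ((hf1 f hf).trans_lt hf.2).ne F).trans ?_
        gcongr
        exact hf1 f hf
    exact ⟨⟨hgloc, hle.trans_lt (ENNReal.mul_lt_top
      (ENNReal.mul_lt_top ENNReal.coe_lt_top enorm_lt_top) hf.2)⟩, hle⟩
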